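/- **Setting.** Let $z=(z_1,\dots,z_d)$ be a random vector, $F_i$ the cdf of $z_i$, and $u_z=(F_1(z_1),\dots,F_d(z_d))$; assume that the law $P_{u_z}$ of $u_z$ has a pdf. For a distribution $P$ on $[0,1]^d$ with pdf $p$ let $h(P)=-\int p\log p\in[-\infty,0]$, and put $h(u_z)=h(P_{u_z})$. Let $\mathcal D_d$ be the set of probability distributions supported on $[0,1]^d$ that have a pdf, and $\mathcal C_d\subset\mathcal D_d$ the set of those whose one-dimensional marginals are uniform on $[0,1]$. Let $\psi_m:[0,1]^d\to\mathbb R^{q_m}$ $(m=0,1,2,\dots)$ be bounded measurable functions and, for $k\ge 1$, $$\phi_m^k(u)=(1,u_1,\dots,u_1^k,\dots,u_d,\dots,u_d^k,\psi_m(u)).$$ For $\beta\in\mathbb R^{q_m}$ put $\alpha^k(\beta)=(1,\tfrac12,\dots,\tfrac1{1+k},\dots,\tfrac12,\dots,\tfrac1{1+k},\beta)$ and (with $\sup\emptyset=-\infty$) $$h_{\rm AM}(\phi_m^k,\beta)=\sup\{h(P):P\in\mathcal D_d,\ E_P[\phi_m^k(u)]=\alpha^k(\beta)\},\qquad h_{\rm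 M}(\psi_m,\beta)=\sup\{h(P):P\in\mathcal C_d,\ E_P[\psi_m(u)]=\beta\}.$$ Let $\beta_m=E_{P_{u_z}}[\psi_m(u)]$ and, for every $m$, let $\hat\beta_{m,n}$ be a consistent estimator of $\beta_m$, i.e. $\hat\beta_{m,n}\to\beta_m$ in probability as $n\to\infty$. We say that $\phi_m^k$ is *non-degenerate* if no non-trivial linear combination of its coordinates vanishes $P_{u_z}$-almost surely, and that $(\phi_m^k)_m$ is a *universal approximator* if for every continuous $f$ on $[0,1]^d$ the uniform distance from $f$ to the linear span of the coordinates of $\phi_m^k$ tends to $0$ as $m\to\infty$. All limits are in $[-\infty,\infty)$, and random ones are in probability. **Theorem.** (A) Let $m$ be such that $\phi_m^k$ is non-degenerate for every $k\ge1$. Then $h_{\rm AM}(\phi_m^k,\hat\beta_{m,n})\to h_{\rm M}(\psi_m,\beta_m)$ as $n\to\infty$ and then $k\to\infty$; that is, $h_{\rm AM}(\phi_m^k,\hat\beta_{m,n})\to h_{\rm AM}(\phi_m^k,\beta_m)$ as $n\to\infty$ for every $k\ge1$, and $h_{\rm AM}(\phi_m^k,\beta_m)\to h_{\rm M}(\psi_m,\beta_m)$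 as $k\to\infty$. Moreover there are $N(k)\in\mathbb N$ such that $h_{\rm AM}(\phi_m^k,\hat\beta_{m,n})\to h_{\rm M}(\psi_m,\beta_m)$ as $k,n\to\infty$ jointly with $n\ge N(k)$; and if $\beta_m$ is an interior point of $\{E_Q[\psi_m(u)]:Q\in\mathcal C_d,\ h(Q)>-\infty\}$, then the same holds as $k,n\to\infty$ jointly without restriction. (B) Let $k\ge1$ be such that $\phi_m^k$ is non-degenerate for every $m$ and $(\phi_m^k)_m$ is a universal approximator. Then $h_{\rm AM}(\phi_m^k,\hat\beta_{m,n})\to h(u_z)$ as $n\to\infty$ and then $m\to\infty$; that is, $h_{\rm AM}(\phi_m^k,\hat\beta_{m,n})\to h_{\rm AM}(\phi_m^k,\beta_m)$ as $n\to\infty$ for every $m$, and $h_{\rm AM}(\phi_m^k,\beta_m)\to h(u_z)$ as $m\to\infty$. Moreover there are $N(m)\in\mathbb N$ such that $h_{\rm AM}(\phi_m^k,\hat\beta_{m,n})\to h(u_z)$ as $m,n\to\infty$ jointly with $n\ge N(m)$. -/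

import Mathlib

open MeasureTheory ProbabilityTheory Filter Topology
open scoped ENNReal

noncomputable section

namespace MaxEntCopula

/-- The unit cube `[0,1]^d`. -/
def cube (d : ℕ) : Set (Fin d → ℝ) := Set.Icc 0 1

/-- Differential entropy `h(P) = -∫ p log p` of a distribution with pdf `p = dP/du`, as an extended
real: the integral of the positive part of `-p log p` minus the integral of its negative part.
(For distributions supported on the unit cube the first integral is finite, so that `h(P)` is
well defined, possibly `-∞`.) -/
def diffEntropy {d : ℕ} (P : Measure (Fin d → ℝ)) : EReal :=
  ((∫⁻ u, ENNReal.ofReal (Real.negMulLog (P.rnDeriv volume u).toReal) : ℝ≥0∞) : EReal) -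
    ((∫⁻ u, ENNReal.ofReal (-Real.negMulLog (P.rnDeriv volume u).toReal) : ℝ≥0∞) : EReal)

/-- `D_d`: the distributions with a pdf that are supported on the unit cube. -/
structure IsCubeLaw {d : ℕ} (P : Measure (Fin d → ℝ)) : Prop where
  prob : IsProbabilityMeasure P
  hasPDF : P ≪ volume
  supp : P (cube d)ᶜ = 0

/-- `C_d`: the copula distributions with a pdf. -/
structure IsCopulaLaw {d : ℕ} (P : Measure (Fin d → ℝ)) : Prop extends IsCubeLaw P where
  uniform_marginals : ∀ i, P.map (fun u => u i) = volume.restrict (Set.Icc (0 : ℝ) 1)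

/-- Coordinatewise expectation `E_P[φ(u)]` of a vector-valued statistic. -/
def expect {d : ℕ} {ι : Type*} (P : Measure (Fin d → ℝ)) (φ : (Fin d → ℝ) → ι → ℝ) : ι → ℝ :=
  fun j => ∫ u, φ u j ∂P

/-- Value of the maximum-entropy problem over the copula distributions `P` with pdf such that
`E_P[φ(u)] = α`; it is `-∞` if the problem is infeasible. -/
def mind {d : ℕ} {ι : Type*} (φ : (Fin d → ℝ) → ι → ℝ) (α : ι → ℝ) : EReal :=
  sSup {h | ∃ P : Measure (Fin d → ℝ), IsCopulaLaw P ∧ expect P φ = α ∧ h = diffEntropy P}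

/-- Value of the relaxed maximum-entropy problem, over all distributions `P` with pdf that are
supported on the cube and such that `E_P[φ(u)] = α`; it is `-∞` if the problem is infeasible. -/
def amind {d : ℕ} {ι : Type*} (φ : (Fin d → ℝ) → ι → ℝ) (α : ι → ℝ) : EReal :=
  sSup {h | ∃ P : Measure (Fin d → ℝ), IsCubeLaw P ∧ expect P φ = α ∧ h = diffEntropy P}

/-- Index set of the coordinates of `(1, u_1, …, u_1^k, …, u_d, …, u_d^k, ψ(u))`; the pair
`(i, j)` stands for the power `u_i^(j+1)`. -/
abbrev StatIndex (d k q : ℕ) : Type := Unit ⊕ (Fin d × Fin k) ⊕ Fin q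

/-- `φ^k(u) = (1, u_1, …, u_1^k, …, u_d, …, u_d^k, ψ(u))`. -/
def stat {d q : ℕ} (k : ℕ) (ψ : (Fin d → ℝ) → Fin q → ℝ) (u : Fin d → ℝ) :
    StatIndex d k q → ℝ :=
  Sum.elim (fun _ => 1) (Sum.elim (fun ij => u ij.1 ^ (ij.2.val + 1)) (ψ u))

/-- `α^k = (1, 1/2, …, 1/(1+k), …, 1/2, …, 1/(1+k), β)`. -/
def statMean (d : ℕ) {q : ℕ} (k : ℕ) (β : Fin q → ℝ) : StatIndex d k q → ℝ :=
  Sum.elim (fun _ => 1) (Sum.elim (fun ij => 1 / (1 + ((ij.2.val + 1 : ℕ) : ℝ))) β)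

/-- `h_M(u; ψ, β)`. -/
def hM {d q : ℕ} (ψ : (Fin d → ℝ) → Fin q → ℝ) (β : Fin q → ℝ) : EReal := mind ψ β

/-- `h_AM(u; φ^k, β)`. -/
def hAM {d q : ℕ} (k : ℕ) (ψ : (Fin d → ℝ) → Fin q → ℝ) (β : Fin q → ℝ) : EReal :=
  amind (stat k ψ) (statMean d k β)

/-- The expectations `E_Q[ψ(u)]` for copula distributions `Q` with pdf and finite entropy (the
entropy of a distribution on the cube is at most zero, hence finite unless it is `-∞`). -/
def copulaMeans {d q : ℕ} (ψ : (Fin d → ℝ) → Fin q → ℝ) : Set (Fin q → ℝ) :=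
  {b | ∃ Q : Measure (Fin d → ℝ), IsCopulaLaw Q ∧ diffEntropy Q ≠ ⊥ ∧ expect Q ψ = b}

/-- The family `(φ_m)_m` is a universal approximator of continuous functions on `[0,1]^d`: the
uniform distance of any continuous function to the linear span of the coordinates of `φ_m` tends
to zero as `m → ∞`. -/
def UniversalApproximator {d : ℕ} {ι : ℕ → Type} [∀ m, Fintype (ι m)]
    (φ : (m : ℕ) → (Fin d → ℝ) → ι m → ℝ) : Prop :=
  ∀ f : (Fin d → ℝ) → ℝ, ContinuousOn f (cube d) → ∀ ε > 0, ∀ᶠ m in atTop,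
    ∃ θ : ι m → ℝ, ∀ u ∈ cube d, |f u - ∑ j, θ j * φ m u j| < ε

/-- The coordinates of `φ` are not linearly dependent `P`-almost surely. -/
def LinIndepAS {d : ℕ} {ι : Type*} [Fintype ι] (P : Measure (Fin d → ℝ))
    (φ : (Fin d → ℝ) → ι → ℝ) : Prop :=
  ∀ θ : ι → ℝ, (∀ᵐ u ∂P, ∑ j, θ j * φ u j = 0) → θ = 0

/-- The copula-uniform dual representation `u_z = (F_1(z_1), …, F_d(z_d))` of a random vector `z`,
where `F_i` is the cdf of `z_i`. -/
def dualRep {Ω : Type*} [MeasurableSpace Ω] {d : ℕ} (μ : Measure Ω) (z : Ω → Fin d → ℝ) :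
    Ω → Fin d → ℝ :=
  fun ω i => cdf (μ.map (fun ω' => z ω' i)) (z ω i)

/-- Convergence in probability of `X i` to a constant `a` along `l`, in a topological space. -/
def TendstoInProb {Ω ι E : Type*} [MeasurableSpace Ω] [TopologicalSpace E] (μ : Measure Ω)
    (X : ι → Ω → E) (l : Filter ι) (a : E) : Prop :=
  ∀ U ∈ 𝓝 a, Tendsto (fun i => μ {ω | X i ω ∉ U}) l (𝓝 0)

/-- The filter of pairs `(r, n)` such that `r, n → ∞` with `n ≥ N(r)`. -/
def jointly (N : ℕ → ℕ) : Filter (ℕ × ℕ) :=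
  (atTop ×ˢ atTop) ⊓ 𝓟 {p | N p.1 ≤ p.2}

end MaxEntCopula

end

/-! Since moments are affine in the law and `-x log x` is concave, the maximal entropy is a concave
function of the prescribed means, and it is at most `0` on the cube. A finite concave function on an
open subset of a finite-dimensional space is continuous. The limit in `n` is therefore continuity at
`β_m`, provided the value is finite near `β_m`. Non-degeneracy ensures this
(`exists_bounded_of_near`): a Gram matrix is invertible, so nearby means are attained by bounded
densities, even if `u_z` itself has entropy `-∞`.

For `k → ∞` the values decrease. Midpoints of near-maximisers remain feasible for the weaker
constraints, so a quantitative form of strict concavity makes near-maximisers Cauchy in `L¹`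
(`exists_limit_density`). By Fatou the limit loses no entropy. It has all the moments of a copula,
and moments determine a law on `[0,1]`, so it is feasible for `hM` (`tendsto_hAM_hM`).

For `m → ∞` entropy is a lower envelope: `h(P)` is the infimum of `∫ e^f - 1 - ∫ f dP` over
continuous `f` (`entropy_le_dual`, `le_entropy_of_forall_le_dual`). An `f` that is almost optimal
for the true law is uniformly close to the span of the statistics. All feasible laws give that span
the same means, so `f` bounds all their entropies almost as well (`tendsto_hAM_diffEntropy`).

The joint limits follow by a diagonal choice of `N`. At interior means, the bounds `hM ≤ hAM ≤ 0`
make the concave functions equi-Lipschitz, so no restriction on `n` is needed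
(`tendsto_hAM_prod_nhds`). -/

noncomputable section

namespace MaxEntCopula

variable {d : ℕ}

/-! ### Densities on the cube and their entropy -/

lemma measurableSet_cube : MeasurableSet (cube d) := measurableSet_Icc

lemma volume_cube : volume (cube d) = 1 := by
  simp [cube, Real.volume_Icc_pi]

lemma integrable_indicator_cube (c : ℝ) :
    Integrable ((cube d).indicator (fun _ => c)) := by
  rw [integrable_indicator_iff measurableSet_cube]
  exact integrableOn_const (by simp [volume_cube])

lemma integral_indicator_cube (c : ℝ) : ∫ u, (cube d).indicator (fun _ => c) u = c := by
  rw [integral_indicator measurableSet_cube]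
  simp [measureReal_def, volume_cube]

lemma integrable_of_le_of_le {α : Type*} [MeasurableSpace α] {μ : Measure α} {f g h : α → ℝ}
    (hg : AEStronglyMeasurable g μ) (hf : Integrable f μ) (hh : Integrable h μ)
    (hfg : ∀ x, f x ≤ g x) (hgh : ∀ x, g x ≤ h x) : Integrable g μ := by
  refine (hf.abs.add hh.abs).mono' hg (Eventually.of_forall fun x => ?_)
  have h1 := neg_abs_le (f x)
  have h2 := le_abs_self (h x)
  have h3 := abs_nonneg (f x)
  have h4 := abs_nonneg (h x)
  simp only [Pi.add_apply, Real.norm_eq_abs]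
  exact abs_le.2 ⟨by linarith [hfg x], by linarith [hgh x]⟩

/-- `g` is a probability density vanishing outside the unit cube. -/
structure IsDensity (g : (Fin d → ℝ) → ℝ) : Prop where
  measurable : Measurable g
  nonneg : ∀ u, 0 ≤ g u
  zero_off : ∀ u ∉ cube d, g u = 0
  integrable : Integrable g
  integral_eq_one : ∫ u, g u = 1

/-- The measure with density `g`. -/
def lawOf (g : (Fin d → ℝ) → ℝ) : Measure (Fin d → ℝ) :=
  volume.withDensity fun u => ENNReal.ofReal (g u)

/-- The entropy of a density, as a real integral. -/
def entropy (g : (Fin d → ℝ) → ℝ) : ℝ := ∫ u, Real.negMulLog (g u)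

/-- A real function which is measurable and bounded on the cube. -/
structure IsCubeBounded (f : (Fin d → ℝ) → ℝ) : Prop where
  measurable : Measurable f
  bound : ∃ C : ℝ, ∀ u ∈ cube d, |f u| ≤ C

lemma integrable_mul_of_zero_off {g f : (Fin d → ℝ) → ℝ} (hg : Integrable g)
    (h0 : ∀ u ∉ cube d, g u = 0) (hf : IsCubeBounded f) : Integrable fun u => g u * f u := by
  obtain ⟨C, hC⟩ := hf.bound
  refine (hg.abs.mul_const C).mono' (hg.1.mul hf.measurable.aestronglyMeasurable)
    (Eventually.of_forall fun u => ?_)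
  rw [Real.norm_eq_abs, abs_mul]
  by_cases hu : u ∈ cube d
  · exact mul_le_mul_of_nonneg_left (hC u hu) (abs_nonneg _)
  · simp [h0 u hu]

/-- The tangent of `-x log x` at `x = 1`. It yields nonpositive entropy and an integrable upper
bound for every entropy integrand. -/
lemma negMulLog_le_indicator {g : (Fin d → ℝ) → ℝ} (hn : ∀ u, 0 ≤ g u)
    (h0 : ∀ u ∉ cube d, g u = 0) (u : Fin d → ℝ) :
    Real.negMulLog (g u) ≤ (cube d).indicator (fun _ => (1 : ℝ)) u - g u := by
  by_cases hu : u ∈ cube d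
  · simpa [hu] using Real.negMulLog_le_one_sub_self (hn u)
  · simp [hu, h0 u hu]

namespace IsDensity

variable {g : (Fin d → ℝ) → ℝ}

lemma integrable_mul (hg : IsDensity g) {f : (Fin d → ℝ) → ℝ} (hf : IsCubeBounded f) :
    Integrable fun u => g u * f u :=
  integrable_mul_of_zero_off hg.integrable hg.zero_off hf

lemma measurable_negMulLog (hg : IsDensity g) : Measurable fun u => Real.negMulLog (g u) :=
  Real.continuous_negMulLog.measurable.comp hg.measurable

lemma entropy_nonpos (hg : IsDensity g) : entropy g ≤ 0 := by
  by_cases hi : Integrable fun u => Real.negMulLog (g u)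
  · have h := integral_mono hi ((integrable_indicator_cube 1).sub hg.integrable)
      (negMulLog_le_indicator hg.nonneg hg.zero_off)
    simp only [Pi.sub_apply] at h
    rw [integral_sub (integrable_indicator_cube 1) hg.integrable, integral_indicator_cube,
      hg.integral_eq_one, sub_self] at h
    exact h
  -- A non-integrable function has Bochner integral `0`, which satisfies the bound.
  · rw [entropy, integral_undef hi]

lemma isCubeLaw (hg : IsDensity g) : IsCubeLaw (lawOf g) where
  prob := ⟨by
    rw [lawOf, withDensity_apply _ MeasurableSet.univ, Measure.restrict_univ,
      ← ofReal_integral_eq_lintegral_ofReal hg.integrable (Eventually.of_forall hg.nonneg),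
      hg.integral_eq_one, ENNReal.ofReal_one]⟩
  hasPDF := withDensity_absolutelyContinuous _ _
  supp := by
    rw [lawOf, withDensity_apply _ measurableSet_cube.compl,
      setLIntegral_eq_zero measurableSet_cube.compl]
    intro u hu
    simp [hg.zero_off u hu]

lemma rnDeriv_toReal (hg : IsDensity g) :
    (fun u => ((lawOf g).rnDeriv volume u).toReal) =ᵐ[volume] g := by
  filter_upwards [Measure.rnDeriv_withDensity volume hg.measurable.ennreal_ofReal] with u hu
  rw [lawOf, hu, ENNReal.toReal_ofReal (hg.nonneg u)]

lemma integral_lawOf (hg : IsDensity g) (f : (Fin d → ℝ) → ℝ) :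
    ∫ u, f u ∂(lawOf g) = ∫ u, g u * f u := by
  rw [lawOf, integral_withDensity_eq_integral_toReal_smul hg.measurable.ennreal_ofReal
    (by simp)]
  simp only [ENNReal.toReal_ofReal (hg.nonneg _), smul_eq_mul]

lemma lintegral_negMulLog_ne_top (hg : IsDensity g) :
    ∫⁻ u, ENNReal.ofReal (Real.negMulLog (g u)) ≠ ∞ := by
  refine ne_top_of_le_ne_top (integrable_indicator_cube (d := d) 1).lintegral_lt_top.ne
    (lintegral_mono fun u => ENNReal.ofReal_le_ofReal ?_)
  have := negMulLog_le_indicator hg.nonneg hg.zero_off u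
  linarith [hg.nonneg u]

lemma diffEntropy_lawOf (hg : IsDensity g) : diffEntropy (lawOf g) =
    ((∫⁻ u, ENNReal.ofReal (Real.negMulLog (g u)) : ℝ≥0∞) : EReal) -
    ((∫⁻ u, ENNReal.ofReal (-Real.negMulLog (g u)) : ℝ≥0∞) : EReal) := by
  have h1 : (fun u => ENNReal.ofReal (Real.negMulLog ((lawOf g).rnDeriv volume u).toReal))
      =ᵐ[volume] fun u => ENNReal.ofReal (Real.negMulLog (g u)) := by
    filter_upwards [hg.rnDeriv_toReal] with u hu
    rw [hu]
  have h2 : (fun u => ENNReal.ofReal (-Real.negMulLog ((lawOf g).rnDeriv volume u).toReal))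
      =ᵐ[volume] fun u => ENNReal.ofReal (-Real.negMulLog (g u)) := by
    filter_upwards [hg.rnDeriv_toReal] with u hu
    rw [hu]
  rw [diffEntropy, lintegral_congr_ae h1, lintegral_congr_ae h2]

lemma diffEntropy_eq (hg : IsDensity g) (hi : Integrable fun u => Real.negMulLog (g u)) :
    diffEntropy (lawOf g) = (entropy g : EReal) := by
  have hneg : ∫⁻ u, ENNReal.ofReal (-Real.negMulLog (g u)) ≠ ∞ := hi.neg.lintegral_lt_top.ne
  rw [hg.diffEntropy_lawOf, entropy, integral_eq_lintegral_pos_part_sub_lintegral_neg_part hi,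
    EReal.coe_sub, EReal.coe_ennreal_toReal hi.lintegral_lt_top.ne,
    EReal.coe_ennreal_toReal hneg]

/-- The positive part always has finite integral, so integrability can fail only through the
negative part. -/
lemma diffEntropy_eq_bot (hg : IsDensity g)
    (hi : ¬ Integrable fun u => Real.negMulLog (g u)) : diffEntropy (lawOf g) = ⊥ := by
  have h2 : ∫⁻ u, ENNReal.ofReal (-Real.negMulLog (g u)) = ∞ := by
    by_contra h
    apply hi
    refine ⟨hg.measurable_negMulLog.aestronglyMeasurable, ?_⟩
    rw [hasFiniteIntegral_iff_norm]
    have : ∀ u, ENNReal.ofReal ‖Real.negMulLog (g u)‖ ≤ ENNReal.ofReal (Real.negMulLog (g u)) +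
        ENNReal.ofReal (-Real.negMulLog (g u)) := by
      intro u
      rcases abs_cases (Real.negMulLog (g u)) with h | h
      · rw [Real.norm_eq_abs, h.1]; exact le_self_add
      · rw [Real.norm_eq_abs, h.1]; exact le_add_self
    refine (lintegral_mono this).trans_lt ?_
    rw [lintegral_add_left hg.measurable_negMulLog.ennreal_ofReal]
    exact ENNReal.add_lt_top.2 ⟨hg.lintegral_negMulLog_ne_top.lt_top, lt_top_iff_ne_top.2 h⟩
  rw [hg.diffEntropy_lawOf, h2, EReal.coe_ennreal_top, sub_eq_add_neg, EReal.neg_top, EReal.add_bot]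

end IsDensity

lemma IsCubeLaw.exists_density {P : Measure (Fin d → ℝ)} (hP : IsCubeLaw P) :
    ∃ g, IsDensity g ∧ P = lawOf g := by
  have := hP.prob
  -- Changing the derivative on a null set makes it vanish everywhere off the cube, so later bounds
  -- hold pointwise.
  set g : (Fin d → ℝ) → ℝ := (cube d).indicator fun u => (P.rnDeriv volume u).toReal with hgdef
  have hmeas : Measurable g :=
    (P.measurable_rnDeriv volume).ennreal_toReal.indicator measurableSet_cube
  have hnn : ∀ u, 0 ≤ g u := Set.indicator_nonneg fun _ _ => ENNReal.toReal_nonneg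
  have hoff : ∀ᵐ u ∂volume, u ∉ cube d → P.rnDeriv volume u = 0 := by
    have h1 : ∫⁻ u in (cube d)ᶜ, P.rnDeriv volume u = 0 := by
      rw [Measure.setLIntegral_rnDeriv hP.hasPDF, hP.supp]
    rw [lintegral_eq_zero_iff (P.measurable_rnDeriv volume)] at h1
    exact (ae_restrict_iff' measurableSet_cube.compl).1 h1
  have hae : (fun u => ENNReal.ofReal (g u)) =ᵐ[volume] P.rnDeriv volume := by
    filter_upwards [hoff, P.rnDeriv_lt_top volume] with u hu hfin
    by_cases hc : u ∈ cube d
    · simp [hgdef, hc, ENNReal.ofReal_toReal hfin.ne]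
    · simp [hgdef, hc, hu hc]
  have hP' : P = lawOf g := by
    rw [lawOf, withDensity_congr_ae hae, Measure.withDensity_rnDeriv_eq _ _ hP.hasPDF]
  have hint : Integrable g :=
    (Measure.integrable_toReal_rnDeriv (μ := P) (ν := volume)).indicator measurableSet_cube
  refine ⟨g, ⟨hmeas, hnn, fun u hu => by simp [hgdef, hu], hint, ?_⟩, hP'⟩
  rw [integral_eq_lintegral_of_nonneg_ae (Eventually.of_forall hnn) hint.1,
    lintegral_congr_ae hae, Measure.lintegral_rnDeriv hP.hasPDF, measure_univ, ENNReal.toReal_one]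

/-! ### Feasible densities and concavity of the value -/

/-- `g` is a density with finite entropy such that `∫ g φ = α`. -/
structure Feasible {ι : Type*} (φ : (Fin d → ℝ) → ι → ℝ) (α : ι → ℝ) (g : (Fin d → ℝ) → ℝ) : Prop
    extends IsDensity g where
  integrable_negMulLog : Integrable fun u => Real.negMulLog (g u)
  moments : ∀ j, ∫ u, g u * φ u j = α j

section Feasible

variable {ι : Type*} {φ : (Fin d → ℝ) → ι → ℝ} {α : ι → ℝ}

lemma Feasible.le_amind {g : (Fin d → ℝ) → ℝ} (hg : Feasible φ α g) :
    (entropy g : EReal) ≤ amind φ α := by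
  refine le_sSup ⟨lawOf g, hg.isCubeLaw, ?_,
    (hg.toIsDensity.diffEntropy_eq hg.integrable_negMulLog).symm⟩
  funext j
  rw [expect, hg.toIsDensity.integral_lawOf, hg.moments]

lemma exists_feasible_of_diffEntropy_ne_bot {P : Measure (Fin d → ℝ)} (hP : IsCubeLaw P)
    (hm : expect P φ = α) (h : diffEntropy P ≠ ⊥) :
    ∃ g, Feasible φ α g ∧ P = lawOf g ∧ diffEntropy P = (entropy g : EReal) := by
  obtain ⟨g, hg, rfl⟩ := hP.exists_density
  have hi : Integrable fun u => Real.negMulLog (g u) := by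
    by_contra hi
    exact h (hg.diffEntropy_eq_bot hi)
  refine ⟨g, ⟨hg, hi, fun j => ?_⟩, rfl, hg.diffEntropy_eq hi⟩
  rw [← hg.integral_lawOf, ← hm, expect]

lemma exists_feasible_of_lt_amind {a : EReal} (ha : a < amind φ α) :
    ∃ g, Feasible φ α g ∧ a < (entropy g : EReal) := by
  obtain ⟨_, ⟨P, hP, hm, rfl⟩, hlt⟩ := lt_sSup_iff.1 ha
  obtain ⟨g, hg, -, he⟩ := exists_feasible_of_diffEntropy_ne_bot hP hm (bot_le.trans_lt hlt).ne'
  exact ⟨g, hg, he ▸ hlt⟩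

/-- Laws of entropy `-∞` do not affect the supremum, so only densities of finite entropy need
testing. -/
lemma amind_le {c : EReal} (h : ∀ g, Feasible φ α g → (entropy g : EReal) ≤ c) :
    amind φ α ≤ c := by
  by_contra hc
  obtain ⟨g, hg, hlt⟩ := exists_feasible_of_lt_amind (not_le.1 hc)
  exact absurd (h g hg) (not_le.2 hlt)

lemma amind_nonpos : amind φ α ≤ 0 :=
  amind_le fun _ hg => by exact_mod_cast hg.toIsDensity.entropy_nonpos

lemma coe_toReal_amind (h : amind φ α ≠ ⊥) : ((amind φ α).toReal : EReal) = amind φ α :=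
  EReal.coe_toReal (amind_nonpos.trans_lt EReal.zero_lt_top).ne h

lemma Feasible.convexComb {β : ι → ℝ} {g h : (Fin d → ℝ) → ℝ}
    (hφ : ∀ j, IsCubeBounded fun u => φ u j) (hg : Feasible φ α g) (hh : Feasible φ β h)
    {s t : ℝ} (hs : 0 ≤ s) (ht : 0 ≤ t) (hst : s + t = 1) :
    Feasible φ (s • α + t • β) (fun u => s * g u + t * h u) := by
  have hn : ∀ u, 0 ≤ s * g u + t * h u := fun u =>
    add_nonneg (mul_nonneg hs (hg.nonneg u)) (mul_nonneg ht (hh.nonneg u))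
  have h0 : ∀ u ∉ cube d, s * g u + t * h u = 0 := fun u hu => by
    rw [hg.zero_off u hu, hh.zero_off u hu]; simp
  have hmeas : Measurable fun u => s * g u + t * h u :=
    (hg.measurable.const_mul s).add (hh.measurable.const_mul t)
  have hint : Integrable fun u => s * g u + t * h u :=
    (hg.integrable.const_mul s).add (hh.integrable.const_mul t)
  refine ⟨⟨hmeas, hn, h0, hint, ?_⟩, ?_, ?_⟩
  · rw [integral_add (hg.integrable.const_mul s) (hh.integrable.const_mul t), integral_const_mul,
      integral_const_mul, hg.integral_eq_one, hh.integral_eq_one]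
    linarith
  -- Concavity bounds the integrand from below, the tangent bound from above.
  · refine integrable_of_le_of_le
      (Real.continuous_negMulLog.measurable.comp hmeas).aestronglyMeasurable
      ((hg.integrable_negMulLog.const_mul s).add (hh.integrable_negMulLog.const_mul t))
      ((integrable_indicator_cube 1).sub hint) (fun u => ?_) (negMulLog_le_indicator hn h0)
    exact Real.concaveOn_negMulLog.2 (hg.nonneg u) (hh.nonneg u) hs ht hst
  · intro j
    have h1 := (hg.toIsDensity.integrable_mul (hφ j)).const_mul s
    have h2 := (hh.toIsDensity.integrable_mul (hφ j)).const_mul t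
    have : (fun u => (s * g u + t * h u) * φ u j) =
        fun u => s * (g u * φ u j) + t * (h u * φ u j) := by
      funext u; ring
    rw [this, integral_add h1 h2, integral_const_mul, integral_const_mul, hg.moments, hh.moments]
    simp

lemma Feasible.entropy_convexComb_ge {β : ι → ℝ} {g h : (Fin d → ℝ) → ℝ}
    (hφ : ∀ j, IsCubeBounded fun u => φ u j)
    (hg : Feasible φ α g) (hh : Feasible φ β h) {s t : ℝ} (hs : 0 ≤ s) (ht : 0 ≤ t)
    (hst : s + t = 1) :
    s * entropy g + t * entropy h ≤ entropy (fun u => s * g u + t * h u) := by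
  rw [entropy, entropy, ← integral_const_mul, ← integral_const_mul,
    ← integral_add (hg.integrable_negMulLog.const_mul s) (hh.integrable_negMulLog.const_mul t)]
  refine integral_mono
    ((hg.integrable_negMulLog.const_mul s).add (hh.integrable_negMulLog.const_mul t))
    (hg.convexComb hφ hh hs ht hst).integrable_negMulLog fun u => ?_
  exact Real.concaveOn_negMulLog.2 (hg.nonneg u) (hh.nonneg u) hs ht hst

lemma exists_feasible_lt_entropy (h : amind φ α ≠ ⊥) {a : ℝ} (ha : a < (amind φ α).toReal) :
    ∃ g, Feasible φ α g ∧ a < entropy g := by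
  have : (a : EReal) < amind φ α := by
    rw [← coe_toReal_amind h]; exact_mod_cast ha
  obtain ⟨g, hg, hlt⟩ := exists_feasible_of_lt_amind this
  exact ⟨g, hg, by exact_mod_cast hlt⟩

lemma Feasible.le_toReal_amind {g : (Fin d → ℝ) → ℝ} (hg : Feasible φ α g) :
    entropy g ≤ (amind φ α).toReal := by
  have h := hg.le_amind
  rw [← coe_toReal_amind (ne_bot_of_le_ne_bot (EReal.coe_ne_bot _) h)] at h
  exact_mod_cast h

/-- The value of the maximum-entropy problem is concave in the prescribed means. -/
lemma concaveOn_toReal_amind {E : Type*} [AddCommGroup E] [Module ℝ E]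
    (hφ : ∀ j, IsCubeBounded fun u => φ u j) {A : E → ι → ℝ}
    (hA : ∀ x y : E, ∀ s t : ℝ, s + t = 1 → A (s • x + t • y) = s • A x + t • A y)
    {S : Set E} (hS : Convex ℝ S) (hne : ∀ x ∈ S, amind φ (A x) ≠ ⊥) :
    ConcaveOn ℝ S fun x => (amind φ (A x)).toReal := by
  refine ⟨hS, fun x hx y hy s t hs ht hst => ?_⟩
  -- The suprema need not be attained, hence near-maximisers.
  refine le_of_forall_pos_sub_le fun ε hε => ?_
  obtain ⟨g, hg, hgx⟩ := exists_feasible_lt_entropy (hne x hx)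
    (sub_lt_self (amind φ (A x)).toReal hε)
  obtain ⟨h, hh, hhy⟩ := exists_feasible_lt_entropy (hne y hy)
    (sub_lt_self (amind φ (A y)).toReal hε)
  have h1 := hg.entropy_convexComb_ge hφ hh hs ht hst
  have h2 := (hg.convexComb hφ hh hs ht hst).le_toReal_amind
  rw [← hA x y s t hst] at h2
  have h3 := mul_le_mul_of_nonneg_left hgx.le hs
  have h4 := mul_le_mul_of_nonneg_left hhy.le ht
  have h5 : s * ε + t * ε = ε := by rw [← add_mul, hst, one_mul]
  simp only [smul_eq_mul]
  linarith

end Feasible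

/-! ### Semicontinuity of entropy and `L¹` limits of near-maximisers -/

/-- Fatou's lemma for the nonnegative functions `1_cube - f n`; with entropy integrands for `f n`
this is upper semicontinuity of entropy. -/
lemma integrable_of_tendsto_of_le_indicator {f : ℕ → (Fin d → ℝ) → ℝ} {F : (Fin d → ℝ) → ℝ}
    {a : ℕ → ℝ} {L : ℝ} (hF : Measurable F) (hf : ∀ n, Measurable (f n))
    (hi : ∀ n, Integrable (f n))
    (hle : ∀ n u, f n u ≤ (cube d).indicator (fun _ => (1 : ℝ)) u)
    (hlim : ∀ᵐ u, Tendsto (fun n => f n u) atTop (𝓝 (F u)))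
    (ha : ∀ n, a n ≤ ∫ u, f n u) (haL : Tendsto a atTop (𝓝 L)) :
    Integrable F ∧ L ≤ ∫ u, F u := by
  set c : (Fin d → ℝ) → ℝ := (cube d).indicator (fun _ => (1 : ℝ)) with hc
  have hcm : Measurable c := measurable_const.indicator measurableSet_cube
  have hci : Integrable c := integrable_indicator_cube 1
  have hFle : ∀ᵐ u, F u ≤ c u := by
    filter_upwards [hlim] with u hu
    exact le_of_tendsto' hu fun n => hle n u
  have hb : ∫⁻ u, ENNReal.ofReal (c u - F u) ≤ ENNReal.ofReal (1 - L) := by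
    calc ∫⁻ u, ENNReal.ofReal (c u - F u)
        = ∫⁻ u, liminf (fun n => ENNReal.ofReal (c u - f n u)) atTop := by
          refine lintegral_congr_ae ?_
          filter_upwards [hlim] with u hu
          exact ((ENNReal.continuous_ofReal.tendsto _).comp (hu.const_sub (c u))).liminf_eq.symm
      _ ≤ liminf (fun n => ∫⁻ u, ENNReal.ofReal (c u - f n u)) atTop :=
          lintegral_liminf_le fun n => (hcm.sub (hf n)).ennreal_ofReal
      _ ≤ liminf (fun n => ENNReal.ofReal (1 - a n)) atTop := by
          refine liminf_le_liminf (Eventually.of_forall fun n => ?_)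
          change ∫⁻ u, ENNReal.ofReal (c u - f n u) ≤ ENNReal.ofReal (1 - a n)
          have hcf : Integrable fun u => c u - f n u := hci.sub (hi n)
          rw [← ofReal_integral_eq_lintegral_ofReal hcf
            (Eventually.of_forall fun u => sub_nonneg.2 (hle n u))]
          refine ENNReal.ofReal_le_ofReal ?_
          rw [integral_sub hci (hi n), hc, integral_indicator_cube]
          linarith [ha n]
      _ = ENNReal.ofReal (1 - L) :=
          ((ENNReal.continuous_ofReal.tendsto _).comp (haL.const_sub 1)).liminf_eq
  have hint : Integrable fun u => c u - F u := by
    refine (lintegral_ofReal_ne_top_iff_integrable (hcm.sub hF).aestronglyMeasurable ?_).1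
      (ne_top_of_le_ne_top ENNReal.ofReal_ne_top hb)
    filter_upwards [hFle] with u hu
    exact sub_nonneg.2 hu
  have hFi : Integrable F := by
    refine (hci.sub hint).congr (Eventually.of_forall fun u => ?_)
    simp
  refine ⟨hFi, ?_⟩
  have hnn : 0 ≤ᵐ[volume] fun u => c u - F u := by
    filter_upwards [hFle] with u hu
    exact sub_nonneg.2 hu
  have hL : 0 ≤ 1 - L := by
    refine ge_of_tendsto' (haL.const_sub 1) fun n => ?_
    have := integral_mono (hi n) hci (hle n)
    rw [hc, integral_indicator_cube] at this
    linarith [ha n]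
  rw [← ofReal_integral_eq_lintegral_ofReal hint hnn, ENNReal.ofReal_le_ofReal_iff hL,
    integral_sub hci hFi, hc, integral_indicator_cube] at hb
  linarith

/-- This is `log t ≤ t - 1` at `t = √m / √a`; the square roots turn a relative entropy into a
Hellinger-type quantity. -/
lemma two_mul_sub_sqrt_le_mul_log {a m : ℝ} (ha : 0 ≤ a) (hm : 0 < m) :
    2 * (a - √a * √m) ≤ a * Real.log a - a * Real.log m := by
  rcases ha.eq_or_lt with rfl | ha
  · simp
  have hsa := Real.sqrt_pos.2 ha
  have hsm := Real.sqrt_pos.2 hm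
  have h1 : Real.log (√m / √a) ≤ √m / √a - 1 := Real.log_le_sub_one_of_pos (by positivity)
  rw [Real.log_div hsm.ne' hsa.ne', Real.log_sqrt hm.le, Real.log_sqrt ha.le] at h1
  have h2 : a * (√m / √a) = √a * √m := by
    nth_rewrite 1 [← Real.mul_self_sqrt ha.le]
    field_simp
  have h3 := mul_le_mul_of_nonneg_left h1 ha.le
  rw [mul_sub, mul_sub, h2] at h3
  linarith

/-- A quantitative form of the concavity of `-x log x`. -/
lemma mul_abs_sub_le_negMulLog_midpoint {a b ε : ℝ} (ha : 0 ≤ a) (hb : 0 ≤ b) :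
    ε * |a - b| ≤ ε ^ 2 * (a + b) + 2 * (Real.negMulLog (1 / 2 * a + 1 / 2 * b) -
      (1 / 2 * Real.negMulLog a + 1 / 2 * Real.negMulLog b)) := by
  set m := 1 / 2 * a + 1 / 2 * b with hm
  rcases (show 0 ≤ m by positivity).eq_or_lt with hm0 | hmpos
  · have ha0 : a = 0 := by linarith
    have hb0 : b = 0 := by linarith
    rw [← hm0]
    simp [ha0, hb0]
  have h1 := two_mul_sub_sqrt_le_mul_log ha hmpos
  have h2 := two_mul_sub_sqrt_le_mul_log hb hmpos
  have key : (√a - √b) ^ 2 / 4 ≤ Real.negMulLog m -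
      (1 / 2 * Real.negMulLog a + 1 / 2 * Real.negMulLog b) := by
    have e : Real.negMulLog m = -(1 / 2 * a + 1 / 2 * b) * Real.log m := by
      rw [Real.negMulLog, ← hm]
    rw [e, Real.negMulLog, Real.negMulLog]
    have sa := Real.mul_self_sqrt ha
    have sb := Real.mul_self_sqrt hb
    have sm := Real.mul_self_sqrt hmpos.le
    -- With `s = √a + √b`, the bounds give a Jensen gap of at least `2m - s√m`, while `(√a - √b)² /
    -- 4 = m - s² / 4`; the difference is `(√m - s/2)²`.
    nlinarith [sq_nonneg (√a + √b - 2 * √m)]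
  have habs : |a - b| = |√a - √b| * (√a + √b) := by
    have sa := Real.mul_self_sqrt ha
    have sb := Real.mul_self_sqrt hb
    have e : a - b = (√a - √b) * (√a + √b) := by linarith
    rw [e, abs_mul, abs_of_nonneg (by positivity : 0 ≤ √a + √b)]
  have hsq : (√a - √b) ^ 2 = |√a - √b| ^ 2 := (sq_abs _).symm
  rw [hsq] at key
  rw [habs]
  have hs : (√a + √b) ^ 2 ≤ 2 * (a + b) := by
    have sa := Real.mul_self_sqrt ha
    have sb := Real.mul_self_sqrt hb
    nlinarith [sq_nonneg (√a - √b)]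
  -- Young's inequality for the factors `|√a - √b|` and `ε(√a + √b)`.
  nlinarith [sq_nonneg (|√a - √b| - ε * (√a + √b)), mul_le_mul_of_nonneg_left hs (sq_nonneg ε)]

lemma isCubeBounded_one : IsCubeBounded (fun _ : Fin d → ℝ => (1 : ℝ)) :=
  ⟨measurable_const, 1, by simp⟩

lemma abs_integral_mul_sub_le {g h f : (Fin d → ℝ) → ℝ} {C : ℝ} (hg : IsDensity g)
    (hh : Integrable h) (h0 : ∀ u ∉ cube d, h u = 0) (hf : Measurable f)
    (hC : ∀ u ∈ cube d, |f u| ≤ C) :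
    |(∫ u, g u * f u) - ∫ u, h u * f u| ≤ C * ∫ u, |g u - h u| := by
  have hfb : IsCubeBounded f := ⟨hf, C, hC⟩
  rw [← integral_sub (hg.integrable_mul hfb) (integrable_mul_of_zero_off hh h0 hfb),
    ← integral_const_mul]
  refine (abs_integral_le_integral_abs).trans (integral_mono_of_nonneg
    (Eventually.of_forall fun _ => abs_nonneg _) ((hg.integrable.sub hh).abs.const_mul C)
    (Eventually.of_forall fun u => ?_))
  simp only [← sub_mul, abs_mul]
  by_cases hu : u ∈ cube d
  · rw [mul_comm]
    exact mul_le_mul_of_nonneg_right (hC u hu) (abs_nonneg _)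
  · simp [hg.zero_off u hu, h0 u hu]

/-- Densities whose entropies converge to the same limit as upper bounds for the entropies of
their midpoints converge in `L¹` to a density of at least that entropy. -/
lemma exists_limit_density {g : ℕ → (Fin d → ℝ) → ℝ} {b : ℕ → ℝ} {L : ℝ}
    (hg : ∀ k, IsDensity (g k)) (hi : ∀ k, Integrable fun u => Real.negMulLog (g k u))
    (hmid : ∀ k j, k ≤ j → Integrable fun u => Real.negMulLog (1 / 2 * g k u + 1 / 2 * g j u))
    (hb : ∀ k j, k ≤ j → entropy (fun u => 1 / 2 * g k u + 1 / 2 * g j u) ≤ b k)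
    (hbL : Tendsto b atTop (𝓝 L)) (hL : Tendsto (fun k => entropy (g k)) atTop (𝓝 L)) :
    ∃ G, IsDensity G ∧ Integrable (fun u => Real.negMulLog (G u)) ∧ L ≤ entropy G ∧
      ∀ f, IsCubeBounded f → Tendsto (fun k => ∫ u, g k u * f u) atTop (𝓝 (∫ u, G u * f u)) := by
  have hL1 : ∀ ε : ℝ, 0 < ε → ∃ K, ∀ k j, K ≤ k → k ≤ j → ∫ u, |g k u - g j u| ≤ 4 * ε := by
    intro ε hε
    -- These tolerances keep the integrated Jensen gap below `ε²`; the pointwise inequality then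
    -- integrates to `ε ‖g k - g j‖₁ ≤ 2ε² + 2ε²`.
    have e1 : ∀ᶠ k in atTop, b k < L + ε ^ 2 / 2 :=
      hbL.eventually_lt_const (by linarith [pow_pos hε 2])
    have e2 : ∀ᶠ k in atTop, L - ε ^ 2 / 2 < entropy (g k) :=
      hL.eventually_const_lt (by linarith [pow_pos hε 2])
    obtain ⟨K, hK⟩ := eventually_atTop.1 (e1.and e2)
    refine ⟨K, fun k j hk hj => ?_⟩
    have hd : Integrable fun u => |g k u - g j u| :=
      ((hg k).integrable.sub (hg j).integrable).abs
    have hA : Integrable fun u => ε ^ 2 * (g k u + g j u) :=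
      ((hg k).integrable.add (hg j).integrable).const_mul _
    have hC : Integrable fun u =>
        1 / 2 * Real.negMulLog (g k u) + 1 / 2 * Real.negMulLog (g j u) :=
      ((hi k).const_mul _).add ((hi j).const_mul _)
    have hB : Integrable fun u => 2 * (Real.negMulLog (1 / 2 * g k u + 1 / 2 * g j u) -
        (1 / 2 * Real.negMulLog (g k u) + 1 / 2 * Real.negMulLog (g j u))) :=
      ((hmid k j hj).sub hC).const_mul 2
    have h := integral_mono (hd.const_mul ε) (hA.add hB)
      (fun u => mul_abs_sub_le_negMulLog_midpoint ((hg k).nonneg u) ((hg j).nonneg u))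
    simp only [Pi.add_apply] at h
    rw [integral_add hA hB, integral_const_mul, integral_const_mul, integral_const_mul,
      integral_add (hg k).integrable (hg j).integrable, integral_sub (hmid k j hj) hC,
      integral_add ((hi k).const_mul _) ((hi j).const_mul _), integral_const_mul,
      integral_const_mul, (hg k).integral_eq_one, (hg j).integral_eq_one] at h
    have hm := hb k j hj
    have h1 := (hK k hk).1
    have h2 := (hK k hk).2
    have h3 := (hK j (hk.trans hj)).2
    simp only [entropy] at hm h2 h3
    have : ε * ∫ u, |g k u - g j u| ≤ ε * (4 * ε) := by nlinarith
    exact le_of_mul_le_mul_left this hε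
  have hcauchy : CauchySeq fun k => (hg k).integrable.toL1 (g k) := by
    refine Metric.cauchySeq_iff'.2 fun ε hε => ?_
    obtain ⟨K, hK⟩ := hL1 (ε / 8) (by positivity)
    refine ⟨K, fun n hn => ?_⟩
    rw [dist_comm, dist_edist, Integrable.edist_toL1_toL1]
    have h := hK K n le_rfl hn
    simp_rw [edist_dist]
    rw [← ofReal_integral_eq_lintegral_ofReal, ENNReal.toReal_ofReal]
    · simp_rw [Real.dist_eq]
      linarith
    · exact integral_nonneg fun _ => dist_nonneg
    · simp_rw [Real.dist_eq]
      exact ((hg K).integrable.sub (hg n).integrable).abs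
    · exact Eventually.of_forall fun _ => dist_nonneg
  obtain ⟨F, hF⟩ := cauchySeq_tendsto_of_complete hcauchy
  have hFi : Integrable F := L1.integrable_coeFn F
  have hFlim : Tendsto (fun k => ∫⁻ u, edist (g k u) (F u)) atTop (𝓝 0) := by
    have h := tendsto_iff_edist_tendsto_0.1 hF
    refine h.congr fun k => ?_
    rw [← Integrable.edist_toL1_toL1 _ _ (hg k).integrable hFi, Integrable.toL1_coeFn]
  have hmeas : TendstoInMeasure volume g atTop F := by
    refine tendstoInMeasure_of_tendsto_eLpNorm one_ne_zero (fun k => (hg k).integrable.1) hFi.1 ?_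
    refine hFlim.congr fun k => ?_
    simp [eLpNorm_one_eq_lintegral_enorm, edist_eq_enorm_sub]
  -- Almost everywhere convergence serves for the sign and support of the limit and for Fatou;
  -- moments converge along the whole sequence.
  obtain ⟨ns, hns, hae⟩ := hmeas.exists_seq_tendsto_ae
  set G : (Fin d → ℝ) → ℝ := (cube d).indicator fun u => max (F u) 0 with hG
  have hGF : G =ᵐ[volume] F := by
    filter_upwards [hae] with u hu
    by_cases hc : u ∈ cube d
    · have : 0 ≤ F u := ge_of_tendsto' hu fun i => (hg _).nonneg u
      simp [hG, hc, this]
    · have : F u = 0 := by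
        refine tendsto_nhds_unique hu ?_
        simp [(hg _).zero_off u hc]
      simp [hG, hc, this]
  have hGm : Measurable G :=
    ((Lp.stronglyMeasurable F).measurable.max measurable_const).indicator measurableSet_cube
  have hGi : Integrable G := hFi.congr hGF.symm
  have hGn : ∀ u, 0 ≤ G u := Set.indicator_nonneg fun _ _ => le_max_right _ _
  have hG0 : ∀ u ∉ cube d, G u = 0 := fun u hu => by simp [hG, hu]
  have hGlim : Tendsto (fun k => ∫ u, |g k u - G u|) atTop (𝓝 0) := by
    have h := (ENNReal.tendsto_toReal ENNReal.zero_ne_top).comp hFlim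
    rw [ENNReal.toReal_zero] at h
    refine h.congr fun k => ?_
    have e : ∫ u, |g k u - G u| = ∫ u, |g k u - F u| := by
      refine integral_congr_ae ?_
      filter_upwards [hGF] with u hu
      rw [hu]
    have hm : AEStronglyMeasurable (fun u => |g k u - F u|) volume :=
      ((hg k).integrable.sub hFi).abs.1
    rw [e, integral_eq_lintegral_of_nonneg_ae (Eventually.of_forall fun _ => abs_nonneg _) hm]
    simp [edist_dist, Real.dist_eq]
  have hmom : ∀ f, IsCubeBounded f →
      Tendsto (fun k => ∫ u, g k u * f u) atTop (𝓝 (∫ u, G u * f u)) := by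
    intro f hf
    obtain ⟨C, hC⟩ := hf.bound
    rw [tendsto_iff_dist_tendsto_zero]
    refine squeeze_zero (fun _ => dist_nonneg)
      (fun k => abs_integral_mul_sub_le (hg k) hGi hG0 hf.measurable hC) ?_
    simpa using hGlim.const_mul C
  have hGd : IsDensity G := by
    refine ⟨hGm, hGn, hG0, hGi, ?_⟩
    have h := hmom _ isCubeBounded_one
    simp only [mul_one, (hg _).integral_eq_one] at h
    exact tendsto_nhds_unique h tendsto_const_nhds
  obtain ⟨hent, hle⟩ := integrable_of_tendsto_of_le_indicator (L := L)
    (f := fun i u => Real.negMulLog (g (ns i) u)) (F := fun u => Real.negMulLog (G u))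
    (a := fun i => entropy (g (ns i))) hGd.measurable_negMulLog
    (fun i => (hg _).measurable_negMulLog) (fun i => hi _)
    (fun i u => by
      have := negMulLog_le_indicator (hg (ns i)).nonneg (hg (ns i)).zero_off u
      linarith [(hg (ns i)).nonneg u])
    (by
      filter_upwards [hae, hGF] with u hu hGu
      rw [hGu]
      exact (Real.continuous_negMulLog.tendsto _).comp hu)
    (fun i => le_rfl) (hL.comp hns.tendsto_atTop)
  exact ⟨G, hGd, hent, hle, hmom⟩

/-! ### Gram matrices and finiteness of the value near the true means -/

lemma IsCubeBounded.mul {f h : (Fin d → ℝ) → ℝ} (hf : IsCubeBounded f) (hh : IsCubeBounded h) :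
    IsCubeBounded fun u => f u * h u := by
  obtain ⟨C, hC⟩ := hf.bound
  obtain ⟨D, hD⟩ := hh.bound
  refine ⟨hf.measurable.mul hh.measurable, C * D, fun u hu => ?_⟩
  rw [abs_mul]
  exact mul_le_mul (hC u hu) (hD u hu) (abs_nonneg _) ((abs_nonneg _).trans (hC u hu))

lemma IsCubeBounded.linComb {ι : Type*} [Fintype ι] {φ : (Fin d → ℝ) → ι → ℝ}
    (hφ : ∀ j, IsCubeBounded fun u => φ u j) (θ : ι → ℝ) :
    IsCubeBounded fun u => ∑ j, θ j * φ u j := by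
  choose C hC using fun j => (hφ j).bound
  refine ⟨Finset.measurable_sum _ fun j _ => (hφ j).measurable.const_mul _,
    ∑ j, |θ j| * C j, fun u hu => ?_⟩
  refine (Finset.abs_sum_le_sum_abs _ _).trans (Finset.sum_le_sum fun j _ => ?_)
  rw [abs_mul]
  exact mul_le_mul_of_nonneg_left (hC j u hu) (abs_nonneg _)

lemma integrable_negMulLog_of_le {g : (Fin d → ℝ) → ℝ} (hg : IsDensity g) {C : ℝ}
    (hC : ∀ u, g u ≤ C) : Integrable fun u => Real.negMulLog (g u) := by
  refine integrable_of_le_of_le hg.measurable_negMulLog.aestronglyMeasurable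
    (hg.integrable.const_mul (-C)) ((integrable_indicator_cube 1).sub hg.integrable) (fun u => ?_)
    (negMulLog_le_indicator hg.nonneg hg.zero_off)
  have h1 := Real.log_le_self (hg.nonneg u)
  have h2 := mul_le_mul_of_nonneg_left (h1.trans (hC u)) (hg.nonneg u)
  rw [Real.negMulLog]
  linarith

section Gram

variable {ι : Type*} [Fintype ι] {φ : (Fin d → ℝ) → ι → ℝ}

/-- The matrix of the integrals `∫ w φ_i φ_j`. -/
def gram (w : (Fin d → ℝ) → ℝ) (φ : (Fin d → ℝ) → ι → ℝ) : Matrix ι ι ℝ :=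
  Matrix.of fun j i => ∫ u, w u * (φ u i * φ u j)

/-- Adding `(∑ θ_i φ_i) w` to a density shifts its moments by the Gram matrix applied to `θ`. -/
lemma gram_mulVec {w : (Fin d → ℝ) → ℝ} (hφ : ∀ j, IsCubeBounded fun u => φ u j)
    (hw : Integrable w) (h0 : ∀ u ∉ cube d, w u = 0) (θ : ι → ℝ) (j : ι) :
    (gram w φ).mulVec θ j = ∫ u, ((∑ i, θ i * φ u i) * w u) * φ u j := by
  have : ∀ u, ((∑ i, θ i * φ u i) * w u) * φ u j =
      ∑ i, w u * (φ u i * φ u j) * θ i := by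
    intro u
    rw [Finset.sum_mul, Finset.sum_mul]
    exact Finset.sum_congr rfl fun i _ => by ring
  simp_rw [this]
  rw [integral_finsetSum]
  · simp only [Matrix.mulVec, dotProduct, gram, Matrix.of_apply, integral_mul_const]
  · intro i _
    exact (integrable_mul_of_zero_off hw h0 ((hφ i).mul (hφ j))).mul_const _

/-- The quadratic form of the matrix is `∫ w (∑ θ_j φ_j)²`, so a kernel vector gives a combination
vanishing where `w ≠ 0`. -/
lemma gram_mulVec_injective {w : (Fin d → ℝ) → ℝ} (hφ : ∀ j, IsCubeBounded fun u => φ u j)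
    (hw : Integrable w) (hn : ∀ u, 0 ≤ w u) (h0 : ∀ u ∉ cube d, w u = 0)
    (hind : ∀ θ : ι → ℝ, (∀ᵐ u, w u ≠ 0 → ∑ j, θ j * φ u j = 0) → θ = 0) :
    Function.Injective (gram w φ).mulVecLin := by
  rw [← LinearMap.ker_eq_bot, LinearMap.ker_eq_bot']
  intro θ hθ
  apply hind
  have hb := IsCubeBounded.linComb hφ θ
  have hi := integrable_mul_of_zero_off hw h0 (hb.mul hb)
  have hzero : ∫ u, w u * ((∑ j, θ j * φ u j) * ∑ j, θ j * φ u j) = 0 := by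
    have h1 : ∀ u, w u * ((∑ j, θ j * φ u j) * ∑ j, θ j * φ u j) =
        ∑ j, θ j * (((∑ i, θ i * φ u i) * w u) * φ u j) := by
      intro u
      rw [← mul_assoc, Finset.mul_sum]
      exact Finset.sum_congr rfl fun j _ => by ring
    simp_rw [h1]
    rw [integral_finsetSum]
    · refine Finset.sum_eq_zero fun j _ => ?_
      rw [integral_const_mul, ← gram_mulVec hφ hw h0]
      have := congrFun hθ j
      rw [Matrix.mulVecLin_apply] at this
      simp [this]
    · intro j _
      refine Integrable.const_mul ?_ _
      refine (integrable_mul_of_zero_off hw h0 (hb.mul (hφ j))).congr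
        (Eventually.of_forall fun u => ?_)
      simp only
      ring
  rw [integral_eq_zero_iff_of_nonneg
    (fun u => mul_nonneg (hn u) (mul_self_nonneg _)) hi] at hzero
  filter_upwards [hzero] with u hu hne
  simpa [hne] using hu

lemma tendsto_integral_min_mul {p f : (Fin d → ℝ) → ℝ} (hp : IsDensity p) (hf : IsCubeBounded f) :
    Tendsto (fun n : ℕ => ∫ u, min (p u) n * f u) atTop (𝓝 (∫ u, p u * f u)) := by
  refine tendsto_integral_of_dominated_convergence (fun u => |p u * f u|) (fun n => ?_)
    (hp.integrable_mul hf).abs (fun n => Eventually.of_forall fun u => ?_)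
    (Eventually.of_forall fun u => ?_)
  · exact ((hp.measurable.min measurable_const).mul hf.measurable).aestronglyMeasurable
  · rw [Real.norm_eq_abs, abs_mul, abs_mul]
    refine mul_le_mul_of_nonneg_right ?_ (abs_nonneg _)
    rw [abs_of_nonneg (hp.nonneg u), abs_of_nonneg (le_min (hp.nonneg u) n.cast_nonneg)]
    exact min_le_left _ _
  · obtain ⟨N, hN⟩ := exists_nat_ge (p u)
    refine tendsto_const_nhds.congr' ?_
    filter_upwards [eventually_ge_atTop N] with n hn
    rw [min_eq_left (hN.trans (by exact_mod_cast hn))]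

/-- If the statistics are linearly independent on the support of `p`, then every vector close to
`∫ p φ` is of the form `∫ g φ` with a bounded nonnegative `g` supported on the cube. -/
lemma exists_bounded_of_near {p : (Fin d → ℝ) → ℝ} (hp : IsDensity p)
    (hφ : ∀ j, IsCubeBounded fun u => φ u j)
    (hind : ∀ θ : ι → ℝ, (∀ᵐ u, p u ≠ 0 → ∑ j, θ j * φ u j = 0) → θ = 0) :
    ∀ᶠ α in 𝓝 (fun j => ∫ u, p u * φ u j), ∃ g : (Fin d → ℝ) → ℝ, Measurable g ∧ (∀ u, 0 ≤ g u) ∧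
      (∀ u ∉ cube d, g u = 0) ∧ Integrable g ∧ (∃ C, ∀ u, g u ≤ C) ∧
      ∀ j, ∫ u, g u * φ u j = α j := by
  -- A bounded weight with the same support as `p`, dominated by every truncation `min p n` with `n
  -- ≥ 1`.
  set w : (Fin d → ℝ) → ℝ := fun u => min (p u) 1 with hw
  have hwm : Measurable w := hp.measurable.min measurable_const
  have hwn : ∀ u, 0 ≤ w u := fun u => le_min (hp.nonneg u) zero_le_one
  have hw0 : ∀ u ∉ cube d, w u = 0 := fun u hu => by simp [hw, hp.zero_off u hu]
  have hmin : ∀ c : ℝ, 0 ≤ c → Integrable fun u => min (p u) c := fun c hc =>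
    integrable_of_le_of_le (hp.measurable.min measurable_const).aestronglyMeasurable
      (integrable_zero _ _ _) hp.integrable (fun u => le_min (hp.nonneg u) hc)
      (fun u => min_le_left _ _)
  have hwi : Integrable w := hmin 1 zero_le_one
  have hinj := gram_mulVec_injective hφ hwi hwn hw0 fun θ hθ => hind θ (by
    filter_upwards [hθ] with u hu hne
    exact hu (lt_min ((hp.nonneg u).lt_of_ne' hne) one_pos).ne')
  set T := LinearEquiv.ofInjectiveEndo _ hinj with hT
  have hTcont : Continuous T.symm := LinearMap.continuous_of_finiteDimensional T.symm.toLinearMap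
  choose C hC using fun j => (hφ j).bound
  -- For a small moment defect `γ`, the correcting combination is at most `1` in absolute value on
  -- the cube.
  have hsmall : ∀ᶠ γ in 𝓝 (0 : ι → ℝ), ∑ j, |T.symm γ j| * C j < 1 := by
    have hcont : Continuous fun γ : ι → ℝ => ∑ j, |T.symm γ j| * C j :=
      continuous_finsetSum _ fun j _ =>
        (((continuous_apply j).comp hTcont).abs).mul continuous_const
    exact hcont.continuousAt.eventually_lt_const (by simp)
  obtain ⟨δ, hδ, hball⟩ := Metric.eventually_nhds_iff_ball.1 hsmall
  have htr : Tendsto (fun n : ℕ => fun j => ∫ u, min (p u) n * φ u j) atTop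
      (𝓝 fun j => ∫ u, p u * φ u j) :=
    tendsto_pi_nhds.2 fun j => tendsto_integral_min_mul hp (hφ j)
  obtain ⟨n, hn, hn1⟩ := ((htr.eventually (Metric.ball_mem_nhds _ (half_pos hδ))).and
    (eventually_ge_atTop 1)).exists
  have hn1' : (1 : ℝ) ≤ n := by exact_mod_cast hn1
  have hn0 : (0 : ℝ) ≤ n := n.cast_nonneg
  filter_upwards [Metric.ball_mem_nhds _ (half_pos hδ)] with α hα
  set γ : ι → ℝ := α - fun j => ∫ u, min (p u) n * φ u j with hγ
  have hγb : γ ∈ Metric.ball (0 : ι → ℝ) δ := by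
    rw [Metric.mem_ball] at hα ⊢
    rw [dist_zero_right, hγ, ← dist_eq_norm]
    exact (dist_triangle_right _ _ _).trans_lt ((add_lt_add hα hn).trans_eq (add_halves δ))
  set θ := T.symm γ with hθ
  have hlc := IsCubeBounded.linComb hφ θ
  have hθ1 : ∀ u ∈ cube d, |∑ j, θ j * φ u j| ≤ 1 := by
    intro u hu
    refine (Finset.abs_sum_le_sum_abs _ _).trans (le_trans (Finset.sum_le_sum fun j _ => ?_)
      (hball γ hγb).le)
    rw [abs_mul]
    exact mul_le_mul_of_nonneg_left (hC j u hu) (abs_nonneg _)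
  have hwabs : ∀ u, |(∑ j, θ j * φ u j) * w u| ≤ w u := by
    intro u
    by_cases hu : u ∈ cube d
    · rw [abs_mul, abs_of_nonneg (hwn u)]
      exact mul_le_of_le_one_left (hwn u) (hθ1 u hu)
    · simp [hw0 u hu]
  have hwmin : ∀ u, w u ≤ min (p u) n := fun u => min_le_min_left _ hn1'
  have hi2 : Integrable fun u => (∑ j, θ j * φ u j) * w u :=
    (integrable_mul_of_zero_off hwi hw0 hlc).congr (Eventually.of_forall fun u => mul_comm _ _)
  -- The truncation has nearly the right moments; the second term corrects them exactly and, being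
  -- at most `w` in size, preserves nonnegativity and boundedness.
  refine ⟨fun u => min (p u) n + (∑ j, θ j * φ u j) * w u,
    (hp.measurable.min measurable_const).add (hlc.measurable.mul hwm), fun u => ?_, fun u hu => ?_,
    (hmin n hn0).add hi2, ⟨n + 1, fun u => ?_⟩, fun j => ?_⟩
  · linarith [neg_le_of_abs_le (hwabs u), hwmin u]
  · simp [hp.zero_off u hu, hw0 u hu]
  · exact add_le_add (min_le_right _ _)
      ((le_abs_self _).trans ((hwabs u).trans (min_le_right _ _)))
  · have e : T θ = γ := T.apply_symm_apply γ
    have e2 : T θ = (gram w φ).mulVec θ := rfl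
    have e3 := congrFun (e2.symm.trans e) j
    rw [gram_mulVec hφ hwi hw0] at e3
    simp_rw [add_mul]
    rw [integral_add, e3, hγ]
    · simp
    · exact integrable_mul_of_zero_off (hmin n hn0)
        (fun u hu => by simp [hp.zero_off u hu]) (hφ j)
    · exact integrable_mul_of_zero_off hi2 (fun u hu => by simp [hw0 u hu]) (hφ j)

/-- The maximum-entropy problem has finite value for all prescribed means, of total mass one, that
are close to those of `p`. -/
lemma eventually_amind_ne_bot {p : (Fin d → ℝ) → ℝ} (hp : IsDensity p)
    (hφ : ∀ j, IsCubeBounded fun u => φ u j) {j₀ : ι} (hj₀ : ∀ u, φ u j₀ = 1)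
    (hind : LinIndepAS (lawOf p) φ) :
    ∀ᶠ α in 𝓝 (fun j => ∫ u, p u * φ u j), α j₀ = 1 → amind φ α ≠ ⊥ := by
  have hind' : ∀ θ : ι → ℝ, (∀ᵐ u, p u ≠ 0 → ∑ j, θ j * φ u j = 0) → θ = 0 := by
    intro θ hθ
    apply hind θ
    rw [lawOf, ae_withDensity_iff hp.measurable.ennreal_ofReal]
    filter_upwards [hθ] with u hu hne
    exact hu fun h => hne (by simp [h])
  filter_upwards [exists_bounded_of_near hp hφ hind'] with α ⟨g, hm, hn, h0, hi, ⟨C, hC⟩, hmom⟩ hα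
  have hg : IsDensity g := by
    refine ⟨hm, hn, h0, hi, ?_⟩
    have := hmom j₀
    simpa [hj₀, hα] using this
  have hf : Feasible φ α g := ⟨hg, integrable_negMulLog_of_le hg hC, hmom⟩
  exact ne_bot_of_le_ne_bot (EReal.coe_ne_bot _) hf.le_amind

end Gram

/-! ### The variational formula for the entropy -/

/-- Fenchel's inequality for `x log x`, from `log t ≤ t - 1` at `t = e^y / x`. -/
lemma negMulLog_le_exp_sub {x : ℝ} (hx : 0 ≤ x) (y : ℝ) :
    Real.negMulLog x ≤ Real.exp y - x - x * y := by
  rcases hx.eq_or_lt with rfl | hx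
  · simp [Real.exp_nonneg]
  have h := Real.log_le_sub_one_of_pos (div_pos (Real.exp_pos y) hx)
  rw [Real.log_div (Real.exp_pos y).ne' hx.ne', Real.log_exp] at h
  have h2 := mul_le_mul_of_nonneg_left h hx.le
  rw [mul_sub, mul_sub, mul_div_cancel₀ _ hx.ne'] at h2
  rw [Real.negMulLog]
  linarith

lemma IsCubeBounded.integrableOn_exp {f : (Fin d → ℝ) → ℝ} (hf : IsCubeBounded f) :
    IntegrableOn (fun u => Real.exp (f u)) (cube d) := by
  obtain ⟨C, hC⟩ := hf.bound
  refine Measure.integrableOn_of_bounded (M := Real.exp C) (by simp [volume_cube])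
    (Real.measurable_exp.comp hf.measurable).aestronglyMeasurable ?_
  filter_upwards [ae_restrict_mem measurableSet_cube] with u hu
  rw [Real.norm_eq_abs, Real.abs_exp]
  exact Real.exp_le_exp.2 ((le_abs_self _).trans (hC u hu))

/-- The functional of the variational formula for the entropy. -/
def dual (p f : (Fin d → ℝ) → ℝ) : ℝ :=
  (∫ u in cube d, Real.exp (f u)) - 1 - ∫ u, p u * f u

lemma entropy_le_dual {g f : (Fin d → ℝ) → ℝ} (hg : IsDensity g)
    (hi : Integrable fun u => Real.negMulLog (g u)) (hf : IsCubeBounded f) :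
    entropy g ≤ dual g f := by
  have he : Integrable ((cube d).indicator fun u => Real.exp (f u)) :=
    (integrable_indicator_iff measurableSet_cube).2 hf.integrableOn_exp
  have hgf := hg.integrable_mul hf
  have hei : Integrable fun u => (cube d).indicator (fun u => Real.exp (f u)) u - g u :=
    he.sub hg.integrable
  have h : entropy g ≤
      ∫ u, ((cube d).indicator (fun u => Real.exp (f u)) u - g u - g u * f u) := by
    refine integral_mono hi (hei.sub hgf) fun u => ?_
    by_cases hu : u ∈ cube d
    · simpa [hu] using negMulLog_le_exp_sub (hg.nonneg u) (f u)
    · simp [hu, hg.zero_off u hu]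
  rwa [integral_sub hei hgf, integral_sub he hg.integrable, hg.integral_eq_one,
    integral_indicator measurableSet_cube] at h

lemma abs_exp_sub_exp_le {x y C : ℝ} (hx : |x| ≤ C) (hy : |y| ≤ C) :
    |Real.exp x - Real.exp y| ≤ Real.exp C * |x - y| := by
  wlog h : y ≤ x generalizing x y
  · rw [abs_sub_comm, abs_sub_comm x y]
    exact this hy hx (not_le.1 h).le
  rw [abs_of_nonneg (sub_nonneg.2 (Real.exp_le_exp.2 h)), abs_of_nonneg (sub_nonneg.2 h)]
  have h1 := Real.add_one_le_exp (y - x)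
  have h2 : Real.exp y = Real.exp x * Real.exp (y - x) := by rw [← Real.exp_add]; congr 1; ring
  have h3 : Real.exp x ≤ Real.exp C := Real.exp_le_exp.2 ((le_abs_self _).trans hx)
  calc Real.exp x - Real.exp y = Real.exp x * (1 - Real.exp (y - x)) := by rw [h2]; ring
    _ ≤ Real.exp x * (x - y) := mul_le_mul_of_nonneg_left (by linarith) (Real.exp_nonneg _)
    _ ≤ Real.exp C * (x - y) := mul_le_mul_of_nonneg_right h3 (sub_nonneg.2 h)

/-- A lower bound of the dual functional on continuous functions extends to bounded measurable
functions. -/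
lemma le_dual_of_forall_continuous {p : (Fin d → ℝ) → ℝ} (hp : IsDensity p) {c : ℝ}
    (hc : ∀ f : (Fin d → ℝ) → ℝ, Continuous f → IsCubeBounded f → c ≤ dual p f)
    {f : (Fin d → ℝ) → ℝ} (hf : Measurable f) {C : ℝ} (hC : ∀ u, |f u| ≤ C) : c ≤ dual p f := by
  have hP : IsProbabilityMeasure (lawOf p) := hp.isCubeLaw.prob
  have hvol : IsFiniteMeasure (volume.restrict (cube d)) := ⟨by simp [volume_cube]⟩
  have hC0 : 0 ≤ C := (abs_nonneg _).trans (hC 0)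
  have hfb : IsCubeBounded f := ⟨hf, C, fun u _ => hC u⟩
  -- The sum of both measures lets one `L¹` approximation control both integrals in `dual`.
  set ρ := volume.restrict (cube d) + lawOf p with hρ
  have hfi : Integrable f ρ :=
    Integrable.of_bound hf.aestronglyMeasurable C (Eventually.of_forall fun u => hC u)
  refine le_of_forall_pos_le_add fun ε hε => ?_
  -- `exp C` is a Lipschitz constant of `exp` on `[-C, C]`; the `1` accounts for the linear term.
  have hK : 0 < Real.exp C + 1 := by positivity
  obtain ⟨h, hh, -⟩ := hfi.exists_boundedContinuous_integral_sub_le (div_pos hε hK)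
  -- Clamping to the range of `f` keeps continuity and does not increase the distance to `f`.
  set t : (Fin d → ℝ) → ℝ := fun u => max (-C) (min (h u) C) with ht
  have htc : Continuous t := continuous_const.max (h.continuous.min continuous_const)
  have htC : ∀ u, |t u| ≤ C := fun u =>
    abs_le.2 ⟨le_max_left _ _, max_le (by linarith) (min_le_right _ _)⟩
  have htb : IsCubeBounded t := ⟨htc.measurable, C, fun u _ => htC u⟩
  have hclamp : ∀ u, |t u - f u| ≤ |f u - h u| := by
    intro u
    obtain ⟨h1, h2⟩ := abs_le.1 (hC u)
    rw [abs_sub_comm (f u)]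
    simp only [ht]
    rcases le_total (h u) C with h3 | h3
    · rw [min_eq_left h3]
      rcases le_total (-C) (h u) with h4 | h4
      · rw [max_eq_right h4]
      · rw [max_eq_left h4, abs_of_nonpos (by linarith), abs_of_nonpos (by linarith)]
        linarith
    · rw [min_eq_right h3, max_eq_right (by linarith), abs_of_nonneg (by linarith),
        abs_of_nonneg (by linarith)]
      linarith
  have hbd : ∀ u, |t u - f u| ≤ 2 * C := fun u => by
    have := abs_sub (t u) (f u)
    linarith [htC u, hC u]
  have hmeas : Measurable fun u => |t u - f u| := (htc.measurable.sub hf).abs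
  have hi1 : Integrable (fun u => |t u - f u|) (volume.restrict (cube d)) :=
    Integrable.of_bound hmeas.aestronglyMeasurable (2 * C)
      (Eventually.of_forall fun u => by simpa using hbd u)
  have hi2 : Integrable (fun u => |t u - f u|) (lawOf p) :=
    Integrable.of_bound hmeas.aestronglyMeasurable (2 * C)
      (Eventually.of_forall fun u => by simpa using hbd u)
  have hsum : (∫ u in cube d, |t u - f u|) + ∫ u, |t u - f u| ∂(lawOf p) ≤
      ε / (Real.exp C + 1) := by
    rw [← integral_add_measure hi1 hi2]
    refine le_trans (integral_mono (hi1.add_measure hi2) ?_ hclamp) hh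
    exact (hfi.sub (h.integrable ρ)).abs
  have hn1 : 0 ≤ ∫ u in cube d, |t u - f u| := integral_nonneg fun _ => abs_nonneg _
  have hn2 : 0 ≤ ∫ u, |t u - f u| ∂(lawOf p) := integral_nonneg fun _ => abs_nonneg _
  have hexp : (∫ u in cube d, Real.exp (t u)) - ∫ u in cube d, Real.exp (f u) ≤
      Real.exp C * ∫ u in cube d, |t u - f u| := by
    rw [← integral_sub htb.integrableOn_exp hfb.integrableOn_exp, ← integral_const_mul]
    refine integral_mono (htb.integrableOn_exp.sub hfb.integrableOn_exp) (hi1.const_mul _)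
      fun u => ?_
    exact (le_abs_self _).trans (abs_exp_sub_exp_le (htC u) (hC u))
  have hlin : (∫ u, p u * f u) - ∫ u, p u * t u ≤ ∫ u, |t u - f u| ∂(lawOf p) := by
    rw [← hp.integral_lawOf, ← hp.integral_lawOf, ← integral_sub]
    · refine integral_mono ?_ hi2 fun u => ?_
      · exact (Integrable.of_bound hf.aestronglyMeasurable C (Eventually.of_forall hC)).sub
          (Integrable.of_bound htc.aestronglyMeasurable C (Eventually.of_forall htC))
      · exact (le_abs_self _).trans (abs_sub_comm _ _).le
    · exact Integrable.of_bound hf.aestronglyMeasurable C (Eventually.of_forall hC)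
    · exact Integrable.of_bound htc.aestronglyMeasurable C (Eventually.of_forall htC)
  have hct := hc t htc htb
  have hfin : Real.exp C * (∫ u in cube d, |t u - f u|) + ∫ u, |t u - f u| ∂(lawOf p) ≤ ε := by
    rw [le_div_iff₀ hK] at hsum
    nlinarith [mul_nonneg (Real.exp_nonneg C) hn2]
  rw [dual] at hct ⊢
  linarith

/-- The entropy of a density is bounded below by any lower bound of the dual functional. -/
lemma le_entropy_of_forall_le_dual {p : (Fin d → ℝ) → ℝ} (hp : IsDensity p) {c : ℝ}
    (hc : ∀ f : (Fin d → ℝ) → ℝ, Continuous f → IsCubeBounded f → c ≤ dual p f) :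
    Integrable (fun u => Real.negMulLog (p u)) ∧ c ≤ entropy p := by
  have hpos : ∀ n : ℕ, (0 : ℝ) < n + 1 := fun n => by positivity
  have hone : ∀ n : ℕ, (1 : ℝ) ≤ n + 1 := fun n => by linarith [(n.cast_nonneg : (0 : ℝ) ≤ n)]
  have hrm : ∀ n : ℕ, Measurable fun u => -(p u * Real.log (min (p u) (n + 1))) := fun n =>
    (hp.measurable.mul (Real.measurable_log.comp (hp.measurable.min measurable_const))).neg
  have hle : ∀ (n : ℕ) u, -(p u * Real.log (min (p u) (n + 1))) ≤
      (cube d).indicator (fun _ => (1 : ℝ)) u := by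
    intro n u
    have hnn := hp.nonneg u
    have hind := negMulLog_le_indicator hp.nonneg hp.zero_off u
    rw [Real.negMulLog] at hind
    rcases le_total (p u) (n + 1) with h | h
    · rw [min_eq_left h]
      linarith
    · rw [min_eq_right h]
      have h1 := mul_nonneg hnn (Real.log_nonneg (hone n))
      have h2 : 0 ≤ (cube d).indicator (fun _ => (1 : ℝ)) u :=
        Set.indicator_nonneg (fun _ _ => zero_le_one) u
      linarith
  have hri : ∀ n : ℕ, Integrable fun u => -(p u * Real.log (min (p u) (n + 1))) := by
    intro n
    refine integrable_of_le_of_le (hrm n).aestronglyMeasurable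
      (hp.integrable.mul_const (-Real.log (n + 1))) (integrable_indicator_cube 1) (fun u => ?_)
      (hle n)
    rcases (hp.nonneg u).eq_or_lt with h0 | h0
    · simp [← h0]
    · have := mul_le_mul_of_nonneg_left
        (Real.log_le_log (lt_min h0 (hpos n)) (min_le_right (p u) (n + 1 : ℝ))) h0.le
      linarith
  refine integrable_of_tendsto_of_le_indicator
    (f := fun (n : ℕ) u => -(p u * Real.log (min (p u) (n + 1))))
    (a := fun n : ℕ => c - 1 / ((n : ℝ) + 1)) hp.measurable_negMulLog hrm hri hle
    (Eventually.of_forall fun u => ?_) (fun n => ?_) ?_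
  · obtain ⟨N, hN⟩ := exists_nat_ge (p u)
    refine tendsto_const_nhds.congr' ?_
    filter_upwards [eventually_ge_atTop N] with n hn
    have : (N : ℝ) ≤ n := by exact_mod_cast hn
    rw [min_eq_left (by linarith), Real.negMulLog, neg_mul]
  -- The formal minimiser of `dual p` is `log p`. Clamping `p` makes the logarithm bounded and costs
  -- at most `1/(n+1)` in `∫ e^f`.
  · set x : (Fin d → ℝ) → ℝ := fun u => max (1 / ((n : ℝ) + 1)) (min (p u) (n + 1)) with hx
    have hx0 : ∀ u, 0 < x u := fun u => lt_max_of_lt_left (by positivity)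
    have hxm : Measurable x := measurable_const.max (hp.measurable.min measurable_const)
    have hlogm : Measurable fun u => Real.log (x u) := Real.measurable_log.comp hxm
    have hlogb : ∀ u, |Real.log (x u)| ≤ Real.log (n + 1) := by
      intro u
      refine abs_le.2 ⟨?_, Real.log_le_log (hx0 u) (max_le ?_ (min_le_right _ _))⟩
      · rw [← Real.log_inv, ← one_div]
        exact Real.log_le_log (by positivity) (le_max_left _ _)
      · exact (div_le_one (hpos n)).2 (hone n) |>.trans (hone n)
    have h := le_dual_of_forall_continuous hp hc hlogm hlogb
    have hxi : (∫ u in cube d, Real.exp (Real.log (x u))) ≤ 1 / ((n : ℝ) + 1) + 1 := by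
      simp_rw [Real.exp_log (hx0 _)]
      have hci : IntegrableOn (fun _ => 1 / ((n : ℝ) + 1)) (cube d) :=
        integrableOn_const (by simp [volume_cube])
      calc ∫ u in cube d, x u ≤ ∫ u in cube d, (1 / ((n : ℝ) + 1) + p u) := by
            have hbi : IntegrableOn (fun u => 1 / ((n : ℝ) + 1) + p u) (cube d) :=
              hci.add hp.integrable.integrableOn
            refine integral_mono_of_nonneg (Eventually.of_forall fun u => (hx0 u).le) hbi
              (Eventually.of_forall fun u => ?_)
            have h1 : (0 : ℝ) < 1 / ((n : ℝ) + 1) := by positivity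
            have h2 := hp.nonneg u
            exact max_le (by linarith) ((min_le_left _ _).trans (by linarith))
        _ = 1 / ((n : ℝ) + 1) + ∫ u in cube d, p u := by
            rw [integral_add hci hp.integrable.integrableOn]
            simp [measureReal_def, volume_cube]
        _ ≤ 1 / ((n : ℝ) + 1) + 1 := by
            have := setIntegral_le_integral (s := cube d) hp.integrable
              (Eventually.of_forall hp.nonneg)
            rw [hp.integral_eq_one] at this
            linarith
    -- The lower clamp only raises the logarithm, so it can be dropped.
    have hlog : ∫ u, -(p u * Real.log (x u)) ≤
        ∫ u, -(p u * Real.log (min (p u) (n + 1))) := by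
      refine integral_mono (hp.integrable_mul ⟨hlogm, _, fun u _ => hlogb u⟩).neg (hri n)
        fun u => ?_
      rcases (hp.nonneg u).eq_or_lt with h0 | h0
      · simp [← h0]
      · have := mul_le_mul_of_nonneg_left (Real.log_le_log (lt_min h0 (hpos n))
          (le_max_right (1 / ((n : ℝ) + 1)) (min (p u) (n + 1)))) h0.le
        exact neg_le_neg this
    rw [integral_neg] at hlog
    rw [dual] at h
    linarith
  · simpa using tendsto_one_div_add_atTop_nhds_zero_nat.const_sub c

/-! ### Uniform marginals and their moments -/

/-- If `F` is the cdf of `Z` and the law of `F(Z)` has a density, then that law is uniform. -/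
lemma map_cdf_eq_uniform {ν : Measure ℝ} [IsProbabilityMeasure ν]
    (hac : ν.map (cdf ν) ≪ volume) : ν.map (cdf ν) = volume.restrict (Set.Icc (0 : ℝ) 1) := by
  have hF : Measurable (cdf ν) := (monotone_cdf ν).measurable
  -- Null level sets rule out atoms of `ν`, hence jumps of the cdf, and make its plateaus
  -- negligible.
  have hlevel : ∀ t : ℝ, ν (cdf ν ⁻¹' {t}) = 0 := fun t => by
    rw [← Measure.map_apply hF (measurableSet_singleton t)]
    exact hac (measure_singleton t)
  have hatom : ∀ x : ℝ, ν {x} = 0 := fun x =>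
    measure_mono_null (by rintro _ rfl; rfl) (hlevel (cdf ν x))
  have hcont : Continuous (cdf ν) := by
    refine continuous_iff_continuousAt.2 fun x => ?_
    rw [(monotone_cdf ν).continuousAt_iff_leftLim_eq_rightLim, (cdf ν).rightLim_eq]
    refine le_antisymm ((monotone_cdf ν).leftLim_le le_rfl) ?_
    have h := (cdf ν).measure_singleton x
    rw [measure_cdf, hatom, eq_comm, ENNReal.ofReal_eq_zero] at h
    linarith
  have hprob : IsProbabilityMeasure (ν.map (cdf ν)) :=
    Measure.isProbabilityMeasure_map hF.aemeasurable
  refine Measure.ext_of_Iic _ _ fun t => ?_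
  rw [Measure.map_apply hF measurableSet_Iic, Measure.restrict_apply measurableSet_Iic]
  rcases le_or_gt t 0 with ht | ht
  · have h1 : ν (cdf ν ⁻¹' Set.Iic t) = 0 := by
      refine measure_mono_null (fun x hx => ?_) (hlevel 0)
      exact le_antisymm ((show cdf ν x ≤ t from hx).trans ht) (cdf_nonneg ν x)
    rw [h1, eq_comm]
    refine measure_mono_null (t := {0}) (fun x hx => ?_) (measure_singleton _)
    exact le_antisymm ((show x ≤ t from hx.1).trans ht) hx.2.1
  rcases le_or_gt 1 t with ht1 | ht1
  · have h1 : cdf ν ⁻¹' Set.Iic t = Set.univ :=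
      Set.eq_univ_of_forall fun x => (cdf_le_one ν x).trans ht1
    have h2 : Set.Iic t ∩ Set.Icc (0 : ℝ) 1 = Set.Icc 0 1 :=
      Set.inter_eq_right.2 fun x hx => hx.2.trans ht1
    rw [h1, h2, measure_univ, Real.volume_Icc, sub_zero, ENNReal.ofReal_one]
  · obtain ⟨x, rfl⟩ : ∃ x, cdf ν x = t := by
      obtain ⟨a, ha⟩ := ((tendsto_cdf_atBot ν).eventually_lt_const ht).exists
      obtain ⟨b, hb⟩ := ((tendsto_cdf_atTop ν).eventually_const_lt ht1).exists
      exact mem_range_of_exists_le_of_exists_ge hcont ⟨a, ha.le⟩ ⟨b, hb.le⟩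
    -- The two sets differ only within a level set of the cdf.
    have h1 : ν (cdf ν ⁻¹' Set.Iic (cdf ν x)) = ν (Set.Iic x) := by
      refine le_antisymm ?_ (measure_mono fun y hy => monotone_cdf ν hy)
      have hsub : cdf ν ⁻¹' Set.Iic (cdf ν x) ⊆ Set.Iic x ∪ cdf ν ⁻¹' {cdf ν x} := by
        intro y hy
        rcases le_total y x with h | h
        · exact Or.inl h
        · exact Or.inr (le_antisymm hy (monotone_cdf ν h))
      refine (measure_mono hsub).trans ((measure_union_le _ _).trans ?_)
      rw [hlevel, add_zero]
    have h2 : Set.Iic (cdf ν x) ∩ Set.Icc (0 : ℝ) 1 = Set.Icc 0 (cdf ν x) := by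
      ext y
      simp only [Set.mem_inter_iff, Set.mem_Iic, Set.mem_Icc]
      constructor
      · rintro ⟨h, h', -⟩
        exact ⟨h', h⟩
      · rintro ⟨h, h'⟩
        exact ⟨h', h, h'.trans ht1.le⟩
    rw [h1, h2, Real.volume_Icc, sub_zero, ofReal_cdf]

lemma isCopulaLaw_dualRep {Ω : Type*} [MeasurableSpace Ω] {μ : Measure Ω} [IsProbabilityMeasure μ]
    {z : Ω → Fin d → ℝ} (hz : Measurable z) (hpdf : μ.map (dualRep μ z) ≪ volume) :
    IsCopulaLaw (μ.map (dualRep μ z)) := by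
  have hzi : ∀ i, Measurable fun ω => z ω i := fun i => (measurable_pi_apply i).comp hz
  have hm : Measurable (dualRep μ z) :=
    measurable_pi_lambda _ fun i => (monotone_cdf _).measurable.comp (hzi i)
  refine ⟨⟨Measure.isProbabilityMeasure_map hm.aemeasurable, hpdf, ?_⟩, fun i => ?_⟩
  · rw [Measure.map_apply hm measurableSet_cube.compl]
    convert measure_empty (μ := μ)
    refine Set.eq_empty_of_forall_notMem fun ω hω => hω ?_
    exact ⟨fun i => cdf_nonneg _ _, fun i => cdf_le_one _ _⟩
  · have hν : IsProbabilityMeasure (μ.map fun ω => z ω i) :=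
      Measure.isProbabilityMeasure_map (hzi i).aemeasurable
    have e : (μ.map (dualRep μ z)).map (fun u => u i) =
        (μ.map fun ω => z ω i).map (cdf (μ.map fun ω => z ω i)) := by
      rw [Measure.map_map (measurable_pi_apply i) hm,
        Measure.map_map (monotone_cdf _).measurable (hzi i)]
      rfl
    rw [e]
    refine map_cdf_eq_uniform ?_
    rw [← e]
    exact (hpdf.map (measurable_pi_apply i)).trans (Measure.quasiMeasurePreserving_eval
      (fun _ : Fin d => (volume : Measure ℝ)) i).absolutelyContinuous

lemma integral_uniform_pow (n : ℕ) :
    ∫ x in Set.Icc (0 : ℝ) 1, x ^ (n + 1) = 1 / (1 + ((n + 1 : ℕ) : ℝ)) := by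
  rw [integral_Icc_eq_integral_Ioc, ← intervalIntegral.integral_of_le zero_le_one, integral_pow]
  simp
  ring

/-- A probability measure on `[0,1]` with the moments of the uniform law is the uniform law. -/
lemma eq_uniform_of_moments {ν : Measure ℝ} [IsProbabilityMeasure ν]
    (hs : ν (Set.Icc (0 : ℝ) 1)ᶜ = 0)
    (hm : ∀ n : ℕ, ∫ x, x ^ (n + 1) ∂ν = 1 / (1 + ((n + 1 : ℕ) : ℝ))) :
    ν = volume.restrict (Set.Icc (0 : ℝ) 1) := by
  set lam := volume.restrict (Set.Icc (0 : ℝ) 1) with hlam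
  have hlp : IsProbabilityMeasure lam := ⟨by simp [hlam]⟩
  have hνae : ∀ᵐ x ∂ν, x ∈ Set.Icc (0 : ℝ) 1 := by
    rw [ae_iff]; exact hs
  have hlae : ∀ᵐ x ∂lam, x ∈ Set.Icc (0 : ℝ) 1 := ae_restrict_mem measurableSet_Icc
  have hint : ∀ (κ : Measure ℝ) [IsProbabilityMeasure κ], (∀ᵐ x ∂κ, x ∈ Set.Icc (0 : ℝ) 1) →
      ∀ f : ℝ → ℝ, Continuous f → Integrable f κ := by
    intro κ _ hκ f hf
    obtain ⟨C, hC⟩ := isCompact_Icc.exists_bound_of_continuousOn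
      (hf.continuousOn (s := Set.Icc 0 1))
    refine Integrable.of_bound hf.aestronglyMeasurable C ?_
    filter_upwards [hκ] with x hx using hC x hx
  have hpow : ∀ n : ℕ, ∫ x, x ^ n ∂ν = ∫ x, x ^ n ∂lam := by
    intro n
    cases n with
    | zero => simp
    | succ n => rw [hm, hlam, integral_uniform_pow]
  have hpoly : ∀ q : Polynomial ℝ, ∫ x, q.eval x ∂ν = ∫ x, q.eval x ∂lam := by
    intro q
    simp_rw [Polynomial.eval_eq_sum_range]
    rw [integral_finsetSum _ fun i _ => hint ν hνae _ (by fun_prop),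
      integral_finsetSum _ fun i _ => hint lam hlae _ (by fun_prop)]
    simp_rw [integral_const_mul, hpow]
  refine ext_of_forall_integral_eq_of_IsFiniteMeasure fun f => ?_
  refine eq_of_forall_dist_le fun ε hε => ?_
  -- Weierstrass: equal integrals of polynomials force equal integrals of continuous functions on
  -- `[0,1]`.
  obtain ⟨q, hq⟩ := exists_polynomial_near_of_continuousOn 0 1 f f.continuous.continuousOn (ε / 2)
    (half_pos hε)
  have hclose : ∀ (κ : Measure ℝ) [IsProbabilityMeasure κ], (∀ᵐ x ∂κ, x ∈ Set.Icc (0 : ℝ) 1) →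
      dist (∫ x, q.eval x ∂κ) (∫ x, f x ∂κ) ≤ ε / 2 := by
    intro κ _ hκ
    rw [Real.dist_eq, ← integral_sub (hint κ hκ _ q.continuous) (hint κ hκ _ f.continuous)]
    have := norm_integral_le_of_norm_le_const (μ := κ) (f := fun x => q.eval x - f x) (C := ε / 2)
      (by filter_upwards [hκ] with x hx using (hq x hx).le)
    simpa using this
  calc dist (∫ x, f x ∂ν) (∫ x, f x ∂lam)
      ≤ dist (∫ x, f x ∂ν) (∫ x, q.eval x ∂ν) + dist (∫ x, q.eval x ∂ν) (∫ x, f x ∂lam) :=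
        dist_triangle _ _ _
    _ ≤ ε / 2 + ε / 2 := by
        refine add_le_add ((dist_comm _ _).trans_le (hclose ν hνae)) ?_
        rw [hpoly]
        exact hclose lam hlae
    _ = ε := add_halves ε

/-- The statistics consisting of all powers of all coordinates and of `ψ`. -/
def fullStat {q : ℕ} (ψ : (Fin d → ℝ) → Fin q → ℝ) (u : Fin d → ℝ) :
    (Fin d × ℕ) ⊕ Fin q → ℝ :=
  Sum.elim (fun ij => u ij.1 ^ (ij.2 + 1)) (ψ u)

/-- The means of `fullStat` under a copula law. -/
def fullMean (d : ℕ) {q : ℕ} (β : Fin q → ℝ) : (Fin d × ℕ) ⊕ Fin q → ℝ :=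
  Sum.elim (fun ij => 1 / (1 + ((ij.2 + 1 : ℕ) : ℝ))) β

lemma IsCopulaLaw.integral_pow {P : Measure (Fin d → ℝ)} (hP : IsCopulaLaw P) (i : Fin d) (n : ℕ) :
    ∫ u, u i ^ (n + 1) ∂P = 1 / (1 + ((n + 1 : ℕ) : ℝ)) := by
  rw [← integral_uniform_pow, ← hP.uniform_marginals i,
    integral_map (measurable_pi_apply i).aemeasurable (by fun_prop)]

lemma IsCubeLaw.isCopulaLaw_iff {P : Measure (Fin d → ℝ)} (hP : IsCubeLaw P) :
    IsCopulaLaw P ↔ ∀ i, ∀ n : ℕ, ∫ u, u i ^ (n + 1) ∂P = 1 / (1 + ((n + 1 : ℕ) : ℝ)) := by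
  refine ⟨fun h => h.integral_pow, fun h => ⟨hP, fun i => ?_⟩⟩
  have := hP.prob
  have hm : Measurable fun u : Fin d → ℝ => u i := measurable_pi_apply i
  have : IsProbabilityMeasure (P.map fun u => u i) :=
    Measure.isProbabilityMeasure_map hm.aemeasurable
  refine eq_uniform_of_moments ?_ fun n => ?_
  · rw [Measure.map_apply hm measurableSet_Icc.compl]
    refine measure_mono_null (t := (cube d)ᶜ) (fun u hu hc => hu ?_) hP.supp
    exact ⟨hc.1 i, hc.2 i⟩
  · rw [integral_map hm.aemeasurable (by fun_prop), h]

lemma expect_fullStat_iff {q : ℕ} {ψ : (Fin d → ℝ) → Fin q → ℝ} {β : Fin q → ℝ}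
    {P : Measure (Fin d → ℝ)} (hP : IsCubeLaw P) :
    expect P (fullStat ψ) = fullMean d β ↔ IsCopulaLaw P ∧ expect P ψ = β := by
  rw [hP.isCopulaLaw_iff]
  constructor
  · intro h
    exact ⟨fun i n => congrFun h (Sum.inl (i, n)), funext fun j => congrFun h (Sum.inr j)⟩
  · rintro ⟨h1, h2⟩
    funext j
    rcases j with ⟨i, n⟩ | j
    · exact h1 i n
    · exact congrFun h2 j

/-- Uniform marginals amount to infinitely many moment constraints, so the results on `amind`, which
allow any index type, apply to the copula problem. -/
lemma hM_eq_amind {q : ℕ} (ψ : (Fin d → ℝ) → Fin q → ℝ) (β : Fin q → ℝ) :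
    hM ψ β = amind (fullStat ψ) (fullMean d β) := by
  unfold hM mind amind
  congr 1
  ext h
  constructor
  · rintro ⟨P, hP, hm, rfl⟩
    exact ⟨P, hP.toIsCubeLaw, (expect_fullStat_iff hP.toIsCubeLaw).2 ⟨hP, hm⟩, rfl⟩
  · rintro ⟨P, hP, hm, rfl⟩
    obtain ⟨h1, h2⟩ := (expect_fullStat_iff hP).1 hm
    exact ⟨P, h1, h2, rfl⟩

lemma IsCopulaLaw.expect_stat {P : Measure (Fin d → ℝ)} (hP : IsCopulaLaw P) (k : ℕ) {q : ℕ}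
    (ψ : (Fin d → ℝ) → Fin q → ℝ) :
    expect P (stat k ψ) = statMean d k (expect P ψ) := by
  have := hP.prob
  funext j
  rcases j with _ | ⟨i, n⟩ | j
  · simp [expect, stat, statMean]
  · exact hP.integral_pow i n
  · rfl

lemma hM_le_hAM {q : ℕ} (k : ℕ) (ψ : (Fin d → ℝ) → Fin q → ℝ) (β : Fin q → ℝ) :
    hM ψ β ≤ hAM k ψ β := by
  refine sSup_le_sSup ?_
  rintro _ ⟨P, hP, rfl, rfl⟩
  exact ⟨P, hP.toIsCubeLaw, hP.expect_stat k ψ, rfl⟩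

/-! ### Continuity and limits of the relaxed values -/

section Stat

variable {q : ℕ} {ψ : (Fin d → ℝ) → Fin q → ℝ}

lemma isCubeBounded_pow (i : Fin d) (n : ℕ) : IsCubeBounded fun u : Fin d → ℝ => u i ^ n := by
  refine ⟨(measurable_pi_apply i).pow_const n, 1, fun u hu => ?_⟩
  rw [abs_pow, abs_of_nonneg (hu.1 i)]
  exact pow_le_one₀ (hu.1 i) (hu.2 i)

lemma isCubeBounded_stat (hψ : ∀ j, IsCubeBounded fun u => ψ u j) (k : ℕ) (j : StatIndex d k q) :
    IsCubeBounded fun u => stat k ψ u j := by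
  rcases j with _ | ⟨i, n⟩ | j
  · exact isCubeBounded_one
  · exact isCubeBounded_pow i _
  · exact hψ j

lemma isCubeBounded_fullStat (hψ : ∀ j, IsCubeBounded fun u => ψ u j) (j : (Fin d × ℕ) ⊕ Fin q) :
    IsCubeBounded fun u => fullStat ψ u j := by
  rcases j with ⟨i, n⟩ | j
  · exact isCubeBounded_pow i _
  · exact hψ j

lemma statMean_affine (k : ℕ) (x y : Fin q → ℝ) (s t : ℝ) (hst : s + t = 1) :
    statMean d k (s • x + t • y) = s • statMean d k x + t • statMean d k y := by
  funext j
  rcases j with _ | ⟨i, n⟩ | j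
  · simp [statMean, hst]
  · simp only [statMean, Sum.elim_inr, Sum.elim_inl, Pi.add_apply, Pi.smul_apply, smul_eq_mul]
    rw [← add_mul, hst, one_mul]
  · simp [statMean]

lemma fullMean_affine (x y : Fin q → ℝ) (s t : ℝ) (hst : s + t = 1) :
    fullMean d (s • x + t • y) = s • fullMean d x + t • fullMean d y := by
  funext j
  rcases j with ⟨i, n⟩ | j
  · simp only [fullMean, Sum.elim_inl, Pi.add_apply, Pi.smul_apply, smul_eq_mul]
    rw [← add_mul, hst, one_mul]
  · simp [fullMean]

lemma continuous_statMean (k : ℕ) : Continuous (statMean d k : (Fin q → ℝ) → _) := by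
  refine continuous_pi fun j => ?_
  rcases j with _ | ⟨i, n⟩ | j
  · exact continuous_const
  · exact continuous_const
  · exact continuous_apply j

lemma coe_toReal_hAM {k : ℕ} {b : Fin q → ℝ} (h : hAM k ψ b ≠ ⊥) :
    ((hAM k ψ b).toReal : EReal) = hAM k ψ b := coe_toReal_amind h

lemma concaveOn_toReal_hAM (hψ : ∀ j, IsCubeBounded fun u => ψ u j) (k : ℕ) {S : Set (Fin q → ℝ)}
    (hS : Convex ℝ S) (hne : ∀ b ∈ S, hAM k ψ b ≠ ⊥) :
    ConcaveOn ℝ S fun b => (hAM k ψ b).toReal :=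
  concaveOn_toReal_amind (isCubeBounded_stat hψ k) (statMean_affine k) hS hne

lemma concaveOn_toReal_hM (hψ : ∀ j, IsCubeBounded fun u => ψ u j) {S : Set (Fin q → ℝ)}
    (hS : Convex ℝ S) (hne : ∀ b ∈ S, hM ψ b ≠ ⊥) :
    ConcaveOn ℝ S fun b => (hM ψ b).toReal := by
  simp_rw [hM_eq_amind] at hne ⊢
  exact concaveOn_toReal_amind (isCubeBounded_fullStat hψ) fullMean_affine hS hne

lemma eventually_hAM_ne_bot (hψ : ∀ j, IsCubeBounded fun u => ψ u j) {P : Measure (Fin d → ℝ)}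
    (hP : IsCopulaLaw P) {k : ℕ} (hind : LinIndepAS P (stat k ψ)) :
    ∀ᶠ b in 𝓝 (expect P ψ), hAM k ψ b ≠ ⊥ := by
  obtain ⟨p, hp, rfl⟩ := hP.toIsCubeLaw.exists_density
  have h := eventually_amind_ne_bot hp (isCubeBounded_stat hψ k) (j₀ := Sum.inl ())
    (fun _ => rfl) hind
  have e : (fun j => ∫ u, p u * stat k ψ u j) = statMean d k (expect (lawOf p) ψ) := by
    rw [← hP.expect_stat]
    funext j
    rw [expect, hp.integral_lawOf]
  rw [e] at h
  filter_upwards [(continuous_statMean k).continuousAt.eventually h] with b hb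
  -- The constant coordinate of `statMean` prescribes total mass one for every `b`.
  exact hb rfl

lemma continuousAt_hAM (hψ : ∀ j, IsCubeBounded fun u => ψ u j) {P : Measure (Fin d → ℝ)}
    (hP : IsCopulaLaw P) {k : ℕ} (hind : LinIndepAS P (stat k ψ)) :
    ContinuousAt (hAM k ψ) (expect P ψ) := by
  obtain ⟨r, hr, hball⟩ := Metric.eventually_nhds_iff_ball.1 (eventually_hAM_ne_bot hψ hP hind)
  have hc := ((concaveOn_toReal_hAM hψ k (convex_ball _ r) hball).continuousOn
    Metric.isOpen_ball).continuousAt (Metric.ball_mem_nhds _ hr)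
  refine (continuous_coe_real_ereal.continuousAt.comp hc).congr ?_
  filter_upwards [Metric.ball_mem_nhds _ hr] with b hb
  exact coe_toReal_hAM (hball b hb)

lemma Feasible.stat_of_le {β : Fin q → ℝ} {g : (Fin d → ℝ) → ℝ} {k l : ℕ} (hkl : k ≤ l)
    (hg : Feasible (stat l ψ) (statMean d l β) g) : Feasible (stat k ψ) (statMean d k β) g := by
  refine ⟨hg.toIsDensity, hg.integrable_negMulLog, fun j => ?_⟩
  rcases j with _ | ⟨i, n⟩ | j
  · exact hg.moments (Sum.inl ())
  · exact hg.moments (Sum.inr (Sum.inl (i, Fin.castLE hkl n)))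
  · exact hg.moments (Sum.inr (Sum.inr j))

lemma antitone_hAM (β : Fin q → ℝ) : Antitone fun k => hAM k ψ β := fun _ _ hkl =>
  amind_le fun _ hg => (hg.stat_of_le hkl).le_amind

/-- The values of the relaxed problems converge to that of the copula problem. -/
lemma tendsto_hAM_hM (hψ : ∀ j, IsCubeBounded fun u => ψ u j) (β : Fin q → ℝ) :
    Tendsto (fun k => hAM k ψ β) atTop (𝓝 (hM ψ β)) := by
  have hlim := tendsto_atTop_iInf (antitone_hAM (ψ := ψ) β)
  suffices h : ⨅ k, hAM k ψ β ≤ hM ψ β by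
    rwa [le_antisymm h (le_iInf fun k => hM_le_hAM k ψ β)] at hlim
  set L := ⨅ k, hAM k ψ β with hL
  by_cases hbot : L = ⊥
  · rw [hbot]
    exact bot_le
  have hne : ∀ k, hAM k ψ β ≠ ⊥ := fun k => ne_bot_of_le_ne_bot hbot (iInf_le _ k)
  have htop : L ≠ ⊤ :=
    ((iInf_le (fun k => hAM k ψ β) 0).trans amind_nonpos).trans_lt EReal.zero_lt_top |>.ne
  have hb : Tendsto (fun k => (hAM k ψ β).toReal) atTop (𝓝 L.toReal) :=
    (EReal.tendsto_toReal htop hbot).comp hlim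
  -- Near-maximisers with error `1/(k+1)`.
  choose g hg hgb using fun k : ℕ => exists_feasible_lt_entropy (hne k)
    (sub_lt_self (hAM k ψ β).toReal (Nat.one_div_pos_of_nat (α := ℝ) (n := k)))
  -- For `j ≥ k`, `g j` satisfies the constraints of level `k`, so the midpoint competes in problem
  -- `k` and its entropy is at most that value.
  have hmid : ∀ k j, k ≤ j → Feasible (stat k ψ) (statMean d k β)
      fun u => 1 / 2 * g k u + 1 / 2 * g j u := by
    intro k j hkj
    have h := (hg k).convexComb (isCubeBounded_stat hψ k) ((hg j).stat_of_le hkj)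
      (s := 1 / 2) (t := 1 / 2) (by norm_num) (by norm_num) (by norm_num)
    rwa [← add_smul, add_halves, one_smul] at h
  have hent : Tendsto (fun k => entropy (g k)) atTop (𝓝 L.toReal) := by
    refine tendsto_of_tendsto_of_tendsto_of_le_of_le ?_ hb (fun k => (hgb k).le)
      fun k => (hg k).le_toReal_amind
    simpa using hb.sub (tendsto_one_div_add_atTop_nhds_zero_nat (𝕜 := ℝ))
  obtain ⟨G, hG, hGi, hGL, hGm⟩ := exists_limit_density (fun k => (hg k).toIsDensity)
    (fun k => (hg k).integrable_negMulLog) (fun k j h => (hmid k j h).integrable_negMulLog)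
    (fun k j h => (hmid k j h).le_toReal_amind) hb hent
  have hfeas : Feasible (fullStat ψ) (fullMean d β) G := by
    refine ⟨hG, hGi, fun j => ?_⟩
    refine tendsto_nhds_unique (hGm _ (isCubeBounded_fullStat hψ j)) ?_
    refine tendsto_const_nhds.congr' ?_
    rcases j with ⟨i, n⟩ | j
    -- The pair `(i, n)` encodes the power `n + 1`, which is constrained as soon as `n < k`.
    · filter_upwards [eventually_gt_atTop n] with k hk
      exact ((hg k).moments (Sum.inr (Sum.inl (i, ⟨n, hk⟩)))).symm
    · exact Eventually.of_forall fun k => ((hg k).moments (Sum.inr (Sum.inr j))).symm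
  rw [hM_eq_amind, ← EReal.coe_toReal htop hbot]
  exact le_trans (by exact_mod_cast hGL) hfeas.le_amind

lemma hM_ne_bot_of_mem_copulaMeans {b : Fin q → ℝ} (hb : b ∈ copulaMeans ψ) : hM ψ b ≠ ⊥ := by
  obtain ⟨Q, hQ, hne, hm⟩ := hb
  exact ne_bot_of_le_ne_bot hne (le_sSup ⟨Q, hQ, hm, rfl⟩)

/-- At interior points of the set of copula means the convergence is locally uniform. -/
lemma tendsto_hAM_prod_nhds (hψ : ∀ j, IsCubeBounded fun u => ψ u j) {β : Fin q → ℝ}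
    (hβ : β ∈ interior (copulaMeans ψ)) :
    Tendsto (fun p : ℕ × (Fin q → ℝ) => hAM p.1 ψ p.2) (atTop ×ˢ 𝓝 β) (𝓝 (hM ψ β)) := by
  obtain ⟨r₀, hr₀, hball⟩ := Metric.mem_nhds_iff.1 (mem_interior_iff_mem_nhds.1 hβ)
  have hMne : ∀ b ∈ Metric.ball β r₀, hM ψ b ≠ ⊥ := fun b hb =>
    hM_ne_bot_of_mem_copulaMeans (hball hb)
  have hMc := ((concaveOn_toReal_hM hψ (convex_ball β r₀) hMne).continuousOn
    Metric.isOpen_ball).continuousAt (Metric.ball_mem_nhds _ hr₀)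
  have hlow : ∀ᶠ b in 𝓝 β, (hM ψ β).toReal - 1 < (hM ψ b).toReal :=
    hMc.eventually_const_lt (by simp)
  obtain ⟨r, hr, hrb⟩ := Metric.eventually_nhds_iff_ball.1
    (hlow.and (Metric.ball_mem_nhds β hr₀))
  have hne : ∀ k, ∀ b ∈ Metric.ball β r, hAM k ψ b ≠ ⊥ := fun k b hb =>
    ne_bot_of_le_ne_bot (hMne b (hrb b hb).2) (hM_le_hAM k ψ b)
  -- Near `β`, continuity of `hM` gives `-C ≤ hM ≤ hAM ≤ 0`, a bound uniform in `k`.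
  set C := -((hM ψ β).toReal - 1) with hC
  have hbound : ∀ k, ∀ b, dist b β < r → |(hAM k ψ b).toReal| ≤ C := by
    intro k b hb
    have h1 : (hM ψ b).toReal ≤ (hAM k ψ b).toReal :=
      EReal.toReal_le_toReal (hM_le_hAM k ψ b) (hMne b (hrb b hb).2)
        (amind_nonpos.trans_lt EReal.zero_lt_top).ne
    have h2 : (hAM k ψ b).toReal ≤ 0 := EReal.toReal_nonpos amind_nonpos
    rw [abs_of_nonpos h2]
    linarith [(hrb b hb).1]
  -- On the half ball the Lipschitz constant of a bounded concave function depends only on the bound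
  -- and the radius, hence not on `k`.
  have hlip := fun k => (concaveOn_toReal_hAM hψ k (convex_ball β r)
    (hne k)).lipschitzOnWith_of_abs_le (half_pos hr) (hbound k)
  set K := (2 * C / (r / 2)).toNNReal
  have hr2 : 0 < r - r / 2 := by linarith
  have hnhds : ∀ᶠ p : ℕ × (Fin q → ℝ) in atTop ×ˢ 𝓝 β, p.2 ∈ Metric.ball β (r - r / 2) :=
    tendsto_snd.eventually (Metric.ball_mem_nhds β hr2)
  have hdiff : Tendsto (fun p : ℕ × (Fin q → ℝ) =>
      (hAM p.1 ψ p.2).toReal - (hAM p.1 ψ β).toReal) (atTop ×ˢ 𝓝 β) (𝓝 0) := by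
    refine squeeze_zero_norm' (a := fun p => K * dist p.2 β) ?_ ?_
    · filter_upwards [hnhds] with p hp
      exact (hlip p.1).dist_le_mul p.2 hp β (Metric.mem_ball_self hr2)
    · have h : Tendsto (fun p : ℕ × (Fin q → ℝ) => dist p.2 β) (atTop ×ˢ 𝓝 β) (𝓝 0) :=
        tendsto_iff_dist_tendsto_zero.1 tendsto_snd
      simpa using h.const_mul (K : ℝ)
  have hMtop : hM ψ β ≠ ⊤ := by
    rw [hM_eq_amind]
    exact (amind_nonpos.trans_lt EReal.zero_lt_top).ne
  have hMbot := hMne β (Metric.mem_ball_self hr₀)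
  have hk : Tendsto (fun p : ℕ × (Fin q → ℝ) => (hAM p.1 ψ β).toReal) (atTop ×ˢ 𝓝 β)
      (𝓝 (hM ψ β).toReal) :=
    ((EReal.tendsto_toReal hMtop hMbot).comp (tendsto_hAM_hM hψ β)).comp tendsto_fst
  have hsum := hdiff.add hk
  simp only [sub_add_cancel, zero_add] at hsum
  have := (continuous_coe_real_ereal.tendsto _).comp hsum
  rw [EReal.coe_toReal hMtop hMbot] at this
  refine this.congr' ?_
  filter_upwards [hnhds] with p hp
  exact coe_toReal_hAM (hne p.1 p.2 (Metric.ball_subset_ball (by linarith) hp))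

/-- With a universal approximator the values of the relaxed problems converge to the entropy. -/
lemma tendsto_hAM_diffEntropy {q : ℕ → ℕ} {ψ : (m : ℕ) → (Fin d → ℝ) → Fin (q m) → ℝ}
    (hψ : ∀ m j, IsCubeBounded fun u => ψ m u j) {P : Measure (Fin d → ℝ)} (hP : IsCopulaLaw P)
    {k : ℕ} (huniv : UniversalApproximator fun m => stat k (ψ m)) :
    Tendsto (fun m => hAM k (ψ m) (expect P (ψ m))) atTop (𝓝 (diffEntropy P)) := by
  have hlow : ∀ m, diffEntropy P ≤ hAM k (ψ m) (expect P (ψ m)) := fun m =>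
    le_sSup ⟨P, hP.toIsCubeLaw, hP.expect_stat k (ψ m), rfl⟩
  refine tendsto_order.2 ⟨fun a ha => Eventually.of_forall fun m => ha.trans_le (hlow m),
    fun b hb => ?_⟩
  obtain ⟨c, hc, hcb⟩ := EReal.lt_iff_exists_real_btwn.1 hb
  obtain ⟨p, hp, rfl⟩ := hP.toIsCubeLaw.exists_density
  -- The variational formula supplies `f`, also when the entropy of `p` is `-∞`.
  obtain ⟨f, hfc, hfb, hfd⟩ : ∃ f : (Fin d → ℝ) → ℝ, Continuous f ∧ IsCubeBounded f ∧
      dual p f < c := by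
    by_contra! hcon
    obtain ⟨hi, hle⟩ := le_entropy_of_forall_le_dual hp hcon
    rw [hp.diffEntropy_eq hi] at hc
    exact absurd hle (not_le.2 (by exact_mod_cast hc))
  -- Half the gap, because the approximation error enters twice, under `g` and under `p`.
  set ε := (c - dual p f) / 2 with hε
  have hε0 : 0 < ε := by rw [hε]; linarith
  filter_upwards [huniv f hfc.continuousOn ε hε0] with m ⟨θ, hθ⟩
  refine lt_of_le_of_lt (amind_le fun g hg => ?_) hcb
  have hgd := hg.toIsDensity
  have hφ := isCubeBounded_stat (hψ m) k
  have hlc := IsCubeBounded.linComb hφ θ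
  have hmean : ∀ h, IsDensity h → |(∫ u, h u * f u) -
      ∫ u, h u * ∑ j, θ j * stat k (ψ m) u j| ≤ ε := by
    intro h hh
    rw [← integral_sub (hh.integrable_mul hfb) (hh.integrable_mul hlc)]
    refine abs_integral_le_integral_abs.trans ?_
    calc ∫ u, |h u * f u - h u * ∑ j, θ j * stat k (ψ m) u j| ≤ ∫ u, h u * ε := by
          refine integral_mono_of_nonneg (Eventually.of_forall fun _ => abs_nonneg _)
            (hh.integrable.mul_const ε) (Eventually.of_forall fun u => ?_)
          simp only [← mul_sub, abs_mul, abs_of_nonneg (hh.nonneg u)]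
          by_cases hu : u ∈ cube d
          · exact mul_le_mul_of_nonneg_left (hθ u hu).le (hh.nonneg u)
          · simp [hh.zero_off u hu]
      _ = ε := by rw [integral_mul_const, hh.integral_eq_one, one_mul]
  have hsum : ∀ h, IsDensity h → ∫ u, h u * ∑ j, θ j * stat k (ψ m) u j =
      ∑ j, θ j * ∫ u, h u * stat k (ψ m) u j := by
    intro h hh
    have : ∀ u, h u * ∑ j, θ j * stat k (ψ m) u j = ∑ j, θ j * (h u * stat k (ψ m) u j) := by
      intro u
      rw [Finset.mul_sum]
      exact Finset.sum_congr rfl fun j _ => by ring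
    simp_rw [this]
    rw [integral_finsetSum _ fun j _ => (hh.integrable_mul (hφ j)).const_mul _]
    simp_rw [integral_const_mul]
  -- Both densities meet the same moment constraints, so they agree on the span.
  have heq : ∫ u, g u * ∑ j, θ j * stat k (ψ m) u j =
      ∫ u, p u * ∑ j, θ j * stat k (ψ m) u j := by
    rw [hsum g hgd, hsum p hp]
    refine Finset.sum_congr rfl fun j _ => ?_
    rw [hg.moments, ← hP.expect_stat, expect, hp.integral_lawOf]
  have h1 := abs_le.1 (hmean g hgd)
  have h2 := abs_le.1 (hmean p hp)
  have h3 := entropy_le_dual hgd hg.integrable_negMulLog hfb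
  have h4 : entropy g ≤ c := by
    rw [dual] at h3 hε
    linarith [h1.1, h2.2]
  exact_mod_cast h4

end Stat

/-! ### Convergence in probability and joint limits -/

section InProbability

variable {Ω E : Type*} [MeasurableSpace Ω] {μ : Measure Ω}

lemma tendstoInProb_of_tendstoInMeasure {E : Type*} [PseudoEMetricSpace E] {ι : Type*}
    {l : Filter ι} {X : ι → Ω → E} {a : E} (h : TendstoInMeasure μ X l fun _ => a) :
    TendstoInProb μ X l a := by
  intro U hU
  obtain ⟨ε, hε, hsub⟩ := EMetric.mem_nhds_iff.1 hU
  refine tendsto_of_tendsto_of_tendsto_of_le_of_le tendsto_const_nhds (h ε hε)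
    (fun _ => bot_le) fun i => measure_mono fun ω hω => ?_
  by_contra hlt
  exact hω (hsub (Metric.mem_eball.2 (not_le.1 hlt)))

variable [TopologicalSpace E]

/-- Convergence on the product filter provides one neighbourhood `B` of `a` valid for all late
indices of `F`, so the exceptional event concerns `X` alone. -/
lemma TendstoInProb.comp_prod {E' ι κ : Type*} [TopologicalSpace E'] {l : Filter ι} {l' : Filter κ}
    {X : κ → Ω → E} {a : E} {b : E'} {F : ι → E → E'} (hX : TendstoInProb μ X l' a)
    (hF : Tendsto (fun p : ι × E => F p.1 p.2) (l ×ˢ 𝓝 a) (𝓝 b)) :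
    TendstoInProb μ (fun (p : ι × κ) ω => F p.1 (X p.2 ω)) (l ×ˢ l') b := by
  intro U hU
  obtain ⟨A, hA, B, hB, hAB⟩ := Filter.mem_prod_iff.1 (hF hU)
  refine tendsto_of_tendsto_of_tendsto_of_le_of_le' tendsto_const_nhds
    ((hX B hB).comp tendsto_snd) (Eventually.of_forall fun _ => bot_le) ?_
  filter_upwards [tendsto_fst.eventually hA] with p hp
  refine measure_mono fun ω hω hB => hω ?_
  exact hAB (Set.mk_mem_prod hp hB)

lemma TendstoInProb.comp_continuousAt {E' κ : Type*} [TopologicalSpace E'] {l : Filter κ}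
    {X : κ → Ω → E} {a : E} {F : E → E'} (hX : TendstoInProb μ X l a) (hF : ContinuousAt F a) :
    TendstoInProb μ (fun i ω => F (X i ω)) l (F a) :=
  fun _ hU => hX _ (hF hU)

/-- Iterated limits in probability can be realized jointly along `n ≥ N(r)`. -/
lemma exists_tendstoInProb_jointly [FirstCountableTopology E] {X : ℕ → ℕ → Ω → E} {v : ℕ → E}
    {a : E} (hX : ∀ᶠ r in atTop, TendstoInProb μ (X r) atTop (v r))
    (hv : Tendsto v atTop (𝓝 a)) :
    ∃ N : ℕ → ℕ, TendstoInProb μ (fun p ω => X p.1 p.2 ω) (jointly N) a := by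
  obtain ⟨U, hU⟩ := (𝓝 a).exists_antitone_basis
  -- Diagonal choice: `N r` serves the basic neighbourhoods `U 0, …, U r` whose interior contains `v
  -- r`, a finite family, with error `1/(r+1)`.
  have hN : ∀ r, ∃ N, TendstoInProb μ (X r) atTop (v r) → ∀ n, N ≤ n → ∀ j ≤ r,
      v r ∈ interior (U j) → μ {ω | X r n ω ∉ U j} ≤ ((r : ℝ≥0∞) + 1)⁻¹ := by
    intro r
    by_cases hr : TendstoInProb μ (X r) atTop (v r)
    · have hfin : ∀ᶠ n in atTop, ∀ j ∈ Set.Iic r, v r ∈ interior (U j) →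
          μ {ω | X r n ω ∉ U j} ≤ ((r : ℝ≥0∞) + 1)⁻¹ := by
        refine (eventually_all_finite (Set.finite_Iic r)).2 fun j _ => ?_
        by_cases hj : v r ∈ interior (U j)
        · have h := ENNReal.tendsto_nhds_zero.1 (hr (U j) (mem_interior_iff_mem_nhds.1 hj))
            ((r : ℝ≥0∞) + 1)⁻¹ (by simp)
          filter_upwards [h] with n hn _ using hn
        · exact Eventually.of_forall fun n h => absurd h hj
      obtain ⟨N, hN⟩ := eventually_atTop.1 hfin
      exact ⟨N, fun _ => hN⟩
    -- Where convergence fails `N r` is arbitrary, since only large `r` matter.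
    · exact ⟨0, fun h => absurd h hr⟩
  choose N hN using hN
  refine ⟨N, fun W hW => ?_⟩
  obtain ⟨j, -, hj⟩ := hU.1.mem_iff.1 hW
  refine ENNReal.tendsto_nhds_zero.2 fun ε hε => ?_
  have hsmall : ∀ᶠ r : ℕ in atTop, ((r : ℝ≥0∞) + 1)⁻¹ ≤ ε := by
    have h := ENNReal.tendsto_inv_nat_nhds_zero.comp (tendsto_add_atTop_nat 1)
    filter_upwards [ENNReal.tendsto_nhds_zero.1 h ε hε] with r hr
    simpa using hr
  have hmem : ∀ᶠ r in atTop, v r ∈ interior (U j) :=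
    hv (interior_mem_nhds.2 (hU.1.mem_of_mem trivial))
  have hev : ∀ᶠ p : ℕ × ℕ in jointly N, N p.1 ≤ p.2 :=
    (mem_inf_of_right (mem_principal_self _) : {p : ℕ × ℕ | N p.1 ≤ p.2} ∈ jointly N)
  have hfst : Tendsto Prod.fst (jointly N) atTop := tendsto_fst.mono_left inf_le_left
  filter_upwards [hev, hfst.eventually (((hX.and hsmall).and hmem).and (eventually_ge_atTop j))]
    with p hp ⟨⟨⟨h1, h2⟩, h3⟩, h4⟩
  refine le_trans (measure_mono fun ω hω h => hω (hj h)) ((hN p.1 h1 p.2 hp j h4 h3).trans h2)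

end InProbability

end MaxEntCopula

end

theorem mainTheorem3 {Ω : Type*} [MeasurableSpace Ω] (μ : Measure Ω) [IsProbabilityMeasure μ]
    (d : ℕ) (z : Ω → Fin d → ℝ) (hz : Measurable z)
    -- `Pu` is the law of the copula-uniform dual representation of `z`; it has a pdf
    (Pu : Measure (Fin d → ℝ)) (hPu : Pu = μ.map (MaxEntCopula.dualRep μ z))
    (hpdf : Pu ≪ volume)
    -- the statistics functions
    (q : ℕ → ℕ) (ψ : (m : ℕ) → (Fin d → ℝ) → Fin (q m) → ℝ)
    (hψ : ∀ m, Measurable (ψ m))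
    (hψb : ∀ m, ∃ C : ℝ, ∀ u ∈ MaxEntCopula.cube d, ∀ j, |ψ m u j| ≤ C)
    -- their expectations and consistent estimators of them
    (β : (m : ℕ) → Fin (q m) → ℝ) (hβ : ∀ m, β m = MaxEntCopula.expect Pu (ψ m))
    (βhat : (m : ℕ) → ℕ → Ω → Fin (q m) → ℝ)
    (hβhat : ∀ m, TendstoInMeasure μ (βhat m) atTop (fun _ => β m)) :
    -- (A)
    (∀ m : ℕ, (∀ k : ℕ, 0 < k → MaxEntCopula.LinIndepAS Pu (MaxEntCopula.stat k (ψ m))) →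
      (∀ k : ℕ, 0 < k →
        MaxEntCopula.TendstoInProb μ (fun n ω => MaxEntCopula.hAM k (ψ m) (βhat m n ω)) atTop
          (MaxEntCopula.hAM k (ψ m) (β m))) ∧
      Tendsto (fun k => MaxEntCopula.hAM k (ψ m) (β m)) atTop
        (𝓝 (MaxEntCopula.hM (ψ m) (β m))) ∧
      (∃ N : ℕ → ℕ, MaxEntCopula.TendstoInProb μ
        (fun p ω => MaxEntCopula.hAM p.1 (ψ m) (βhat m p.2 ω)) (MaxEntCopula.jointly N)
        (MaxEntCopula.hM (ψ m) (β m))) ∧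
      (β m ∈ interior (MaxEntCopula.copulaMeans (ψ m)) → MaxEntCopula.TendstoInProb μ
        (fun p ω => MaxEntCopula.hAM p.1 (ψ m) (βhat m p.2 ω))
        ((atTop : Filter ℕ) ×ˢ (atTop : Filter ℕ)) (MaxEntCopula.hM (ψ m) (β m)))) ∧
    -- (B)
    (∀ k : ℕ, 0 < k → (∀ m, MaxEntCopula.LinIndepAS Pu (MaxEntCopula.stat k (ψ m))) →
      MaxEntCopula.UniversalApproximator (fun m => MaxEntCopula.stat k (ψ m)) →
      (∀ m : ℕ,
        MaxEntCopula.TendstoInProb μ (fun n ω => MaxEntCopula.hAM k (ψ m) (βhat m n ω)) atTop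
          (MaxEntCopula.hAM k (ψ m) (β m))) ∧
      Tendsto (fun m => MaxEntCopula.hAM k (ψ m) (β m)) atTop
        (𝓝 (MaxEntCopula.diffEntropy Pu)) ∧
      ∃ N : ℕ → ℕ, MaxEntCopula.TendstoInProb μ
        (fun p ω => MaxEntCopula.hAM k (ψ p.1) (βhat p.1 p.2 ω)) (MaxEntCopula.jointly N)
        (MaxEntCopula.diffEntropy Pu)) := by
  have hP : MaxEntCopula.IsCopulaLaw Pu := by
    rw [hPu] at hpdf ⊢
    exact MaxEntCopula.isCopulaLaw_dualRep hz hpdf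
  obtain rfl : β = fun m => MaxEntCopula.expect Pu (ψ m) := funext hβ
  have hb : ∀ m j, MaxEntCopula.IsCubeBounded fun u => ψ m u j := fun m j =>
    ⟨(measurable_pi_apply j).comp (hψ m), (hψb m).imp fun _ h u hu => h u hu j⟩
  have hX := fun m => MaxEntCopula.tendstoInProb_of_tendstoInMeasure (hβhat m)
  refine ⟨fun m hind => ?_, fun k _ hind huniv => ?_⟩
  · have hk : ∀ k : ℕ, 0 < k → MaxEntCopula.TendstoInProb μ
        (fun n ω => MaxEntCopula.hAM k (ψ m) (βhat m n ω)) atTop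
        (MaxEntCopula.hAM k (ψ m) (MaxEntCopula.expect Pu (ψ m))) := fun k hk =>
      (hX m).comp_continuousAt (MaxEntCopula.continuousAt_hAM (hb m) hP (hind k hk))
    have hlim := MaxEntCopula.tendsto_hAM_hM (hb m) (MaxEntCopula.expect Pu (ψ m))
    refine ⟨hk, hlim, ?_, fun hint => ?_⟩
    · exact MaxEntCopula.exists_tendstoInProb_jointly
        (X := fun k n ω => MaxEntCopula.hAM k (ψ m) (βhat m n ω))
        -- Non-degeneracy is available only for `k > 0`, which suffices eventually.
        ((eventually_gt_atTop 0).mono hk) hlim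
    · exact (hX m).comp_prod (F := fun k b => MaxEntCopula.hAM k (ψ m) b)
        (MaxEntCopula.tendsto_hAM_prod_nhds (hb m) hint)
  · have hm : ∀ m : ℕ, MaxEntCopula.TendstoInProb μ
        (fun n ω => MaxEntCopula.hAM k (ψ m) (βhat m n ω)) atTop
        (MaxEntCopula.hAM k (ψ m) (MaxEntCopula.expect Pu (ψ m))) := fun m =>
      (hX m).comp_continuousAt (MaxEntCopula.continuousAt_hAM (hb m) hP (hind m))
    have hlim := MaxEntCopula.tendsto_hAM_diffEntropy hb hP huniv
    exact ⟨hm, hlim, MaxEntCopula.exists_tendstoInProb_jointly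
      (X := fun m n ω => MaxEntCopula.hAM k (ψ m) (βhat m n ω)) (Eventually.of_forall hm) hlim⟩
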